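/- For $N\ge 2$ let $\Pi_N$ be the Platonic graph: its vertices are the classes $[\lambda,\mu]=\{\pm(\lambda,\mu)\}$ of pairs $(\lambda,\mu)\in(\mathbb Z/N)^2$ with $\gcd(\lambda,\mu,N)=1$, and $[\lambda,\mu]$, $[\nu,\omega]$ are joined by an edge if and only if $\lambda\omega-\mu\nu=\pm1$. Let $\mathcal S(\Pi_N)$ be the closed oriented surface glued from the triangles of the quotient $\mathcal F/\Gamma(N)$ of the Farey tessellation $\mathcal F$ of the hyperbolic plane by the principal congruence subgroup $\Gamma(N)\le PSL(2,\mathbb Z)$ (each ideal triangle being replaced by a compact one, with the same gluing of sides); it is triangulated by $\Pi_N$. Let $\widetilde G=\langle x_0,\dots,x_6\mid x_ix_{i+1}x_{i+3},\ i=0,\dots,6\rangle$ (indices modulo $7$) and let $G\le\widetilde G$ be the subgroup generated by $x_0,x_1,x_3$. Represent $\widetilde G$ by infinite upper triangular matrices of $3\times3$ blocks over $\mathbb F_2$ with $3$-periodic diagonals and identity diagonal blocks, as follows. Let $u\in\mathbb F_8$ with $u^3=u+1$, let $\mathbb F_8[[\pi]]$ be the skew power series ring with $\pi a=a^2\pi$,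 and let $t=\pi^3/(1+\pi^3)$; the matrix of $x_i$ is that of the conjugation $y\mapsto g^{-1}yg$ with $g=1+u^i\pi$, acting on row vectors, in the $\mathbb F_2$-basis $b\,\pi^jt^n$ with $b\in\{1,u^2,u\}$, $j\in\{0,1,2\}$, $n\ge0$, the $3\times 3$ blocks being numbered by $j+3n$. Let $H_k$ be the group of all matrices of this shape whose first $k$ upper diagonals are zero, and let $G_k=G/(G\cap H_k)$, where $G\cap H_k$ is the set of elements of $G$ represented by matrices in $H_k$. Let $X_k$ be the Cayley graph of $G_k$ with respect to $x_0^{\pm1},x_1^{\pm1},x_3^{\pm1}$, and let $T_k$ be obtained from $X_k$ by the $(\Delta$-$Y)$-transformation of all its triangles: every triangle becomes a new vertex joined to the three vertices of the triangle, and the edges of the triangles are removed. Let $\mathcal S(T_k)$ be the closed oriented surface that is the $G_k$-covering, with punctures filled in, of the $3$-punctured sphere glued from a black and a white triangle, given by $\gamma_0\mapsto x_0$, $\gamma_1\mapsto x_1$, $\gamma_2\mapsto x_3$ for simple counterclockwise loops $\gamma_i$ around the punctures with $\gamma_0\gamma_1\gamma_2=1$. It is triangulated by the $2|G_k|$ lifted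 black and white triangles; denote this triangulation by $T_k^*$. Write $g(\mathcal S)$ for the genus of $\mathcal S$ and $|E(\cdot)|$ for the number of edges. Then $$\lim_{N\to\infty}\frac{6\,g(\mathcal S(\Pi_N))}{|E(\Pi_N)|}=1\qquad\text{and}\qquad\lim_{k\to\infty}\frac{6\,g(\mathcal S(T_k))}{|E(T_k^*)|}=1 .$$ In the second case, for every $k\ge2$, the triangulation $T_k^*$ of $\mathcal S(T_k)$ is dual to $T_k$ (the graph whose vertices are the triangles of $T_k^*$, two of them being adjacent when they share an edge, is isomorphic to $T_k$), and $T_k$ and $T_k^*$ have the same number of edges. -/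

import Mathlib

open Filter Topology
open scoped MatrixGroups

/-! ### Closed oriented surfaces glued from triangles -/

/-- A closed connected oriented surface, presented as a finite collection of oriented triangles
whose sides are glued in pairs by orientation reversing identifications.
`Side` is the set of all sides of the (disjoint) triangles, each one directed along the
counterclockwise orientation of the boundary of its triangle; `next s` is the side that follows
`s` on the boundary of the same triangle, and `glue s` is the side (of the same or of another
triangle) to which `s` is glued. -/
structure TriangulatedSurface where
  /-- The directed sides of the triangles. -/
  Side : Type
  /-- The next side of the same triangle, in counterclockwise order. -/
  next : Equiv.Perm Side
  /-- The side to which a given side is glued, the initial point of each going to the end point of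
  the other. -/
  glue : Equiv.Perm Side
  finite : Finite Side
  nonempty : Nonempty Side
  next_next_next : ∀ s, next (next (next s)) = s
  next_ne : ∀ s, next s ≠ s
  glue_glue : ∀ s, glue (glue s) = s
  glue_ne : ∀ s, glue s ≠ s
  /-- The surface is connected. -/
  connected : ∀ s t, ∃ w ∈ Subgroup.closure {next, glue}, w s = t

namespace TriangulatedSurface

variable (S : TriangulatedSurface)

/-- The faces (triangles) of the triangulation: a triangle is the set of its three sides. -/
abbrev Face : Type := Quotient (Equiv.Perm.SameCycle.setoid S.next)

/-- The edges of the triangulation: an edge is a pair of sides glued to each other. -/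
abbrev Edge : Type := Quotient (Equiv.Perm.SameCycle.setoid S.glue)

/-- The vertices of the triangulation. The side `glue s` runs from the end point of `s` to its
initial point, so `next (glue s)` starts at the same vertex as `s`; a vertex is the set of all the
sides that start at it. -/
abbrev Vertex : Type := Quotient (Equiv.Perm.SameCycle.setoid (S.next * S.glue))

/-- The Euler characteristic `V - E + F`. -/
noncomputable def eulerChar : ℤ :=
  (Nat.card S.Vertex : ℤ) - (Nat.card S.Edge : ℤ) + (Nat.card S.Face : ℤ)

/-- The genus `g` of the closed connected oriented surface, `χ = 2 - 2 g`. -/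
noncomputable def genus : ℚ := (2 - (S.eulerChar : ℚ)) / 2

/-- The dual graph of the triangulation: its vertices are the triangles, two of them being joined
if they have a common edge. -/
def dualGraph : SimpleGraph S.Face where
  Adj f f' := f ≠ f' ∧ ∃ s : S.Side, (⟦s⟧ : S.Face) = f ∧ (⟦S.glue s⟧ : S.Face) = f'
  symm := ⟨by
    rintro f f' ⟨hne, s, hs, hs'⟩
    exact ⟨hne.symm, S.glue s, hs', by rw [S.glue_glue]; exact hs⟩⟩
  loopless := ⟨fun _ h => h.1 rfl⟩

end TriangulatedSurface

/-! ### Platonic graphs and their surfaces -/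

/-- The pairs `(a, b)` in `ℤ/N × ℤ/N` with `gcd(a, b, N) = 1`. -/
abbrev PrimitivePair (N : ℕ) : Type :=
  {p : ZMod N × ZMod N // Nat.gcd (Nat.gcd p.1.val p.2.val) N = 1}

/-- The relation `p = ± q` on primitive pairs. -/
def primitivePairSetoid (N : ℕ) : Setoid (PrimitivePair N) where
  r p q := p.1 = q.1 ∨ p.1 = -q.1
  iseqv := ⟨fun _ => Or.inl rfl,
    by
      rintro p q (h | h)
      · exact Or.inl h.symm
      · exact Or.inr (by rw [h, neg_neg]),
    by
      rintro p q r (h | h) (h' | h')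
      · exact Or.inl (h.trans h')
      · exact Or.inr (h.trans h')
      · exact Or.inr (by rw [h, h'])
      · exact Or.inl (by rw [h, h', neg_neg])⟩

/-- The vertices `[a, b] = {± (a, b)}` of the Platonic graph. -/
abbrev PlatonicVertex (N : ℕ) : Type := Quotient (primitivePairSetoid N)

/-- The Platonic graph `Π_N`: `[a, b]` and `[c, d]` are joined iff `a d - b c = ± 1`.
(For `N ≥ 2` this determinant condition already excludes loops.) -/
def platonicGraph (N : ℕ) : SimpleGraph (PlatonicVertex N) where
  Adj u v := u ≠ v ∧ ∃ p q : PrimitivePair N,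
    Quotient.mk (primitivePairSetoid N) p = u ∧ Quotient.mk (primitivePairSetoid N) q = v ∧
      (p.1.1 * q.1.2 - p.1.2 * q.1.1 = 1 ∨ p.1.1 * q.1.2 - p.1.2 * q.1.1 = -1)
  symm := ⟨by
    rintro u v ⟨hne, p, q, hp, hq, h⟩
    refine ⟨hne.symm, q, p, hq, hp, ?_⟩
    rcases h with h | h
    · right; rw [← h]; ring
    · left; rw [← neg_eq_iff_eq_neg] at h; rw [← h]; ring⟩
  loopless := ⟨fun _ h => h.1 rfl⟩

/-- The matrices in `SL(2, ℤ)` congruent to `± 1` modulo `N`, i.e. the preimage in `SL(2, ℤ)` of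
the principal congruence subgroup `Γ(N)` of `PSL(2, ℤ)`. -/
def principalCongruence (N : ℕ) : Subgroup SL(2, ℤ) where
  carrier := {g | (Matrix.SpecialLinearGroup.map (Int.castRingHom (ZMod N)) g : SL(2, ZMod N)) = 1 ∨
    (Matrix.SpecialLinearGroup.map (Int.castRingHom (ZMod N)) g : SL(2, ZMod N)) = -1}
  one_mem' := Or.inl (map_one _)
  mul_mem' := by
    rintro a b (ha | ha) (hb | hb) <;> simp only [Set.mem_ofPred_eq, map_mul, ha, hb] <;> simp
  inv_mem' := by
    rintro a (ha | ha)
    · left; rw [map_inv, ha, inv_one]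
    · right; rw [map_inv, ha, inv_eq_iff_mul_eq_one]; simp

instance principalCongruence_normal (N : ℕ) : (principalCongruence N).Normal where
  conj_mem := by
    rintro n (hn | hn) g
    · left; rw [map_mul, map_mul, map_inv, hn]; simp
    · right; rw [map_mul, map_mul, map_inv, hn]; simp

/-- The quotient of the modular group `PSL(2, ℤ)` by `Γ(N)`. -/
abbrev ModularQuotient (N : ℕ) : Type := SL(2, ℤ) ⧸ principalCongruence N

theorem modularQuotient_finite (N : ℕ) (hN : N ≠ 0) : Finite (ModularQuotient N) := by
  have : NeZero N := ⟨hN⟩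
  have hle : CongruenceSubgroup.Gamma N ≤ principalCongruence N := by
    intro g hg
    exact Or.inl hg
  have : (principalCongruence N).FiniteIndex := Subgroup.finiteIndex_of_le hle
  infer_instance

/-- Right multiplication by a generating pair acts transitively on a group. -/
theorem exists_mulRight_closure {Q : Type*} [Group Q] (a b : Q)
    (h : Subgroup.closure {a, b} = ⊤) (s t : Q) :
    ∃ w ∈ Subgroup.closure {Equiv.mulRight a, Equiv.mulRight b}, w s = t := by
  have key : ∀ g ∈ Subgroup.closure {a, b},
      Equiv.mulRight g ∈ Subgroup.closure {Equiv.mulRight a, Equiv.mulRight b} := by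
    intro g hg
    induction hg using Subgroup.closure_induction with
    | mem x hx =>
      rcases hx with rfl | rfl
      · exact Subgroup.subset_closure (Or.inl rfl)
      · exact Subgroup.subset_closure (Or.inr rfl)
    | one => rw [Equiv.mulRight_one]; exact Subgroup.one_mem _
    | mul x y _ _ hx hy =>
      have : Equiv.mulRight (x * y) = Equiv.mulRight y * Equiv.mulRight x := by
        ext z; simp [mul_assoc]
      rw [this]; exact Subgroup.mul_mem _ hy hx
    | inv x _ hx =>
      have : Equiv.mulRight x⁻¹ = (Equiv.mulRight x)⁻¹ := by
        rw [Equiv.inv_mulRight]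
      rw [this]; exact Subgroup.inv_mem _ hx
  refine ⟨Equiv.mulRight (s⁻¹ * t), key _ (h ▸ Subgroup.mem_top _), by simp⟩

theorem modularQuotient_closure (N : ℕ) :
    Subgroup.closure {((ModularGroup.S * ModularGroup.T : SL(2, ℤ)) : ModularQuotient N),
      ((ModularGroup.S : SL(2, ℤ)) : ModularQuotient N)} = ⊤ := by
  have h : Subgroup.closure {(ModularGroup.S * ModularGroup.T : SL(2, ℤ)), ModularGroup.S} = ⊤ := by
    rw [eq_top_iff, ← SpecialLinearGroup.SL2Z_generators, Subgroup.closure_le]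
    have hS : (ModularGroup.S : SL(2, ℤ)) ∈ Subgroup.closure
        {(ModularGroup.S * ModularGroup.T : SL(2, ℤ)), ModularGroup.S} :=
      Subgroup.subset_closure (Or.inr rfl)
    rintro x (rfl | rfl)
    · exact hS
    · have := Subgroup.mul_mem _ (Subgroup.inv_mem _ hS) (Subgroup.subset_closure
        (Or.inl rfl : (ModularGroup.S * ModularGroup.T : SL(2, ℤ)) ∈
          ({ModularGroup.S * ModularGroup.T, ModularGroup.S} : Set SL(2, ℤ))))
      rwa [inv_mul_cancel_left] at this
  have h2 := congrArg (Subgroup.map (QuotientGroup.mk' (principalCongruence N))) h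
  rw [MonoidHom.map_closure, Set.image_pair, Subgroup.map_top_of_surjective _
    (QuotientGroup.mk'_surjective _)] at h2
  exact h2

theorem not_mem_principalCongruence (N : ℕ) [N.AtLeastTwo] (g : SL(2, ℤ)) (hg : g 1 0 = 1) :
    g ∉ principalCongruence N := by
  have : Fact (1 < N) := ⟨Nat.AtLeastTwo.one_lt⟩
  rintro (h | h)
  all_goals
    have h10 := congrArg (fun m : SL(2, ZMod N) => m 1 0) h
    simp [hg] at h10

/-- The surface of the Platonic graph `Π_N`, glued from the triangles of the Farey tessellation
modulo `Γ(N)`.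
The directed sides of the Farey triangles are the directed geodesics from `a/c` to `b/d` with
`a d - b c = 1`, that is, the matrices `±(a, b; c, d)` in `PSL(2, ℤ)`. With the column vectors
`u = (a, c)` and `v = (b, d)`, the side `(u, v)` belongs to the triangle with the sides
`(u, v)`, `(v, v - u)`, `(v - u, -u)`, and the side `(v, -u)` is the same geodesic
with the opposite direction. In terms of matrices, `(u, v) ↦ (v, v - u)` is the right
multiplication by `S T = (0, -1; 1, 1)`, and `(u, v) ↦ (v, -u)` is the right multiplication by
`S = (0, -1; 1, 0)`; both commute with the action of `PSL(2, ℤ)` on the left. -/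
def platonicSurface (N : ℕ) [N.AtLeastTwo] : TriangulatedSurface where
  Side := ModularQuotient N
  next := Equiv.mulRight ((ModularGroup.S * ModularGroup.T : SL(2, ℤ)) : ModularQuotient N)
  glue := Equiv.mulRight ((ModularGroup.S : SL(2, ℤ)) : ModularQuotient N)
  finite := modularQuotient_finite N (Nat.AtLeastTwo.one_lt.ne_bot)
  nonempty := ⟨1⟩
  next_next_next := by
    have h : ((ModularGroup.S * ModularGroup.T : SL(2, ℤ)) : ModularQuotient N) *
        ((ModularGroup.S * ModularGroup.T : SL(2, ℤ)) : ModularQuotient N) *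
        ((ModularGroup.S * ModularGroup.T : SL(2, ℤ)) : ModularQuotient N) = 1 := by
      rw [← QuotientGroup.mk_mul, ← QuotientGroup.mk_mul, QuotientGroup.eq_one_iff]
      have h3 : (ModularGroup.S * ModularGroup.T) * (ModularGroup.S * ModularGroup.T) *
          (ModularGroup.S * ModularGroup.T) = (-1 : SL(2, ℤ)) := by decide
      rw [h3]
      right
      ext i j
      fin_cases i <;> fin_cases j <;> simp
    intro s
    simp only [Equiv.coe_mulRight, mul_assoc] at h ⊢
    rw [h, mul_one]
  next_ne s := by
    simp only [Equiv.coe_mulRight, ne_eq, mul_eq_left]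
    rw [QuotientGroup.eq_one_iff]
    exact not_mem_principalCongruence N _ (by decide)
  glue_glue := by
    have h : ((ModularGroup.S : SL(2, ℤ)) : ModularQuotient N) *
        ((ModularGroup.S : SL(2, ℤ)) : ModularQuotient N) = 1 := by
      rw [← QuotientGroup.mk_mul, QuotientGroup.eq_one_iff]
      have h2 : ModularGroup.S * ModularGroup.S = (-1 : SL(2, ℤ)) := by decide
      rw [h2]
      right
      ext i j
      fin_cases i <;> fin_cases j <;> simp
    intro s
    simp only [Equiv.coe_mulRight, mul_assoc]
    rw [h, mul_one]
  glue_ne s := by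
    simp only [Equiv.coe_mulRight, ne_eq, mul_eq_left]
    rw [QuotientGroup.eq_one_iff]
    exact not_mem_principalCongruence N _ (by decide)
  connected := exists_mulRight_closure _ _ (modularQuotient_closure N)

/-! ### Surfaces glued from black and white triangles by means of a group -/

/-- The translation that belongs to the passage from a black to a white triangle through the side
number `i`, for the covering surface defined below. -/
def crossing {Q : Type*} [Group Q] (x : Fin 3 → Q) : Fin 3 → Q := ![x 2, 1, (x 0)⁻¹]

/-- The counterclockwise succession of the sides of the triangles of the covering surface below:
the colour `true` stands for black and `false` for white. -/
def coverNext (Q : Type) : Equiv.Perm (Q × Bool × Fin 3) where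
  toFun s := (s.1, s.2.1, if s.2.1 then s.2.2 + 1 else s.2.2 - 1)
  invFun s := (s.1, s.2.1, if s.2.1 then s.2.2 - 1 else s.2.2 + 1)
  left_inv := by rintro ⟨h, c, i⟩; cases c <;> simp
  right_inv := by rintro ⟨h, c, i⟩; cases c <;> simp

/-- The gluing of the sides of the triangles of the covering surface below: the side number `i` of
the black triangle `h` is glued to the side number `i` of the white triangle
`h * crossing x i`. -/
def coverGlue {Q : Type} [Group Q] (x : Fin 3 → Q) : Equiv.Perm (Q × Bool × Fin 3) where
  toFun s := (if s.2.1 then s.1 * crossing x s.2.2 else s.1 * (crossing x s.2.2)⁻¹, !s.2.1, s.2.2)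
  invFun s := (if s.2.1 then s.1 * crossing x s.2.2 else s.1 * (crossing x s.2.2)⁻¹, !s.2.1, s.2.2)
  left_inv := by rintro ⟨h, c, i⟩; cases c <;> simp
  right_inv := by rintro ⟨h, c, i⟩; cases c <;> simp

theorem cover_connected {Q : Type} [Group Q] (x : Fin 3 → Q) (hprod : x 0 * x 1 * x 2 = 1)
    (hgen : Subgroup.closure (Set.range x) = ⊤) (s t : Q × Bool × Fin 3) :
    ∃ w ∈ Subgroup.closure {coverNext Q, coverGlue x}, w s = t := by
  let r : Q × Bool × Fin 3 → Q × Bool × Fin 3 → Prop := fun s t =>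
    ∃ w ∈ Subgroup.closure {coverNext Q, coverGlue x}, w s = t
  have rfl' : ∀ s, r s s := fun s => ⟨1, Subgroup.one_mem _, rfl⟩
  have symm' : ∀ {s t}, r s t → r t s := by
    rintro s t ⟨w, hw, rfl⟩
    exact ⟨w⁻¹, Subgroup.inv_mem _ hw, by simp⟩
  have trans' : ∀ {s t u}, r s t → r t u → r s u := by
    rintro s t u ⟨w, hw, rfl⟩ ⟨w', hw', rfl⟩
    exact ⟨w' * w, Subgroup.mul_mem _ hw' hw, rfl⟩
  have hnext : ∀ s, r s (coverNext Q s) := fun s =>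
    ⟨_, Subgroup.subset_closure (Or.inl rfl), rfl⟩
  have hglue : ∀ s, r s (coverGlue x s) := fun s =>
    ⟨_, Subgroup.subset_closure (Or.inr rfl), rfl⟩
  have h1 : ∀ h c i, r (h, c, i) (h, c, i + 1) := by
    intro h c i
    cases c
    · have := hnext (h, false, i + 1)
      simp only [coverNext, Equiv.coe_fn_mk, Bool.false_eq_true, if_false,
        add_sub_cancel_right] at this
      exact symm' this
    · exact hnext (h, true, i)
  have h2 : ∀ h c i, r (h, c, 0) (h, c, i) := by
    intro h c i
    fin_cases i
    · exact rfl' _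
    · exact h1 h c 0
    · exact trans' (h1 h c 0) (h1 h c 1)
  have h3 : ∀ h c i, r (h, c, i) (h, true, 0) := by
    intro h c i
    refine trans' (symm' (h2 h c i)) ?_
    cases c
    · have := hglue (h, true, 1)
      simp only [coverGlue, crossing, Equiv.coe_fn_mk, if_true, Matrix.cons_val_one,
        Matrix.cons_val_zero, mul_one, Bool.not_true] at this
      exact trans' (h2 h false 1) (trans' (symm' this) (symm' (h2 h true 1)))
    · exact rfl' _
  have h4 : ∀ h i, r (h, true, 0) (h * crossing x i, true, 0) := by
    intro h i
    exact trans' (h2 h true i) (trans' (hglue (h, true, i)) (h3 _ _ _))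
  have hx0 : ∀ h, r (h, true, 0) (h * x 0, true, 0) := by
    intro h
    have := h4 (h * x 0) 2
    simp only [crossing, Matrix.cons_val, mul_inv_cancel_right] at this
    exact symm' this
  have hx2 : ∀ h, r (h, true, 0) (h * x 2, true, 0) := fun h => h4 h 0
  have hx1 : ∀ h, r (h, true, 0) (h * x 1, true, 0) := by
    intro h
    have a := hx2 (h * x 1)
    have b := hx0 (h * x 1 * x 2)
    have e : h * x 1 * x 2 * x 0 = h := by
      have : x 1 * x 2 * x 0 = 1 := by
        rw [mul_assoc] at hprod
        rw [eq_inv_of_mul_eq_one_right hprod, inv_mul_cancel]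
      rw [mul_assoc h, mul_assoc h, this, mul_one]
    rw [e] at b
    exact symm' (trans' a b)
  have h5 : ∀ g ∈ Subgroup.closure (Set.range x), ∀ h, r (h, true, 0) (h * g, true, 0) := by
    intro g hg
    induction hg using Subgroup.closure_induction with
    | mem y hy =>
      obtain ⟨i, rfl⟩ := hy
      fin_cases i
      · exact hx0
      · exact hx1
      · exact hx2
    | one => intro h; rw [mul_one]; exact rfl' _
    | mul a b _ _ ha hb =>
      intro h
      rw [← mul_assoc]
      exact trans' (ha h) (hb _)
    | inv a _ ha =>
      intro h
      have := ha (h * a⁻¹)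
      rw [inv_mul_cancel_right] at this
      exact symm' this
  have h6 := h5 (s.1⁻¹ * t.1) (hgen ▸ Subgroup.mem_top _) s.1
  rw [mul_inv_cancel_left] at h6
  exact trans' (h3 s.1 s.2.1 s.2.2) (trans' h6 (symm' (h3 t.1 t.2.1 t.2.2)))

/-- The covering of the 3-punctured sphere (glued from one black and one white triangle)
that belongs to a finite group `Q` and generators `x 0, x 1, x 2` with `x 0 * x 1 * x 2 = 1`, with
its punctures filled in.

The black triangle and the white triangle of the sphere have the vertices `v_0, v_1, v_2`, in
counterclockwise order for the black one and in clockwise order for the white one, and the side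
number `i` of each of them is the one opposite to `v_i`. The surface consists of a black triangle
`(h, true)` and a white triangle `(h, false)` for each `h : Q`, and the side number `i` of the black
triangle `h` is glued to the side number `i` of the white triangle `h * crossing x i`.

A counterclockwise loop `γ_0` around `v_0` leaves the black triangle through the side number `1` and
comes back to it through the side number `2`; its lift leads from the black triangle `h` to the
black triangle `h * crossing x 1 * (crossing x 2)⁻¹ = h * x 0`. In the same way, the lifts of the
loops `γ_1`, `γ_2` around `v_1`, `v_2` lead from `h` to
`h * crossing x 2 * (crossing x 0)⁻¹ = h * x 1` and
`h * crossing x 0 * (crossing x 1)⁻¹ = h * x 2`: this is the covering that belongs to the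
homomorphism from the fundamental group `⟨γ_0, γ_1, γ_2 | γ_0 γ_1 γ_2⟩` onto `Q` with
`γ_i ↦ x i`. -/
def coveringSurface (Q : Type) [Group Q] (x : Fin 3 → Q) (hfin : Finite Q)
    (hprod : x 0 * x 1 * x 2 = 1) (hgen : Subgroup.closure (Set.range x) = ⊤) :
    TriangulatedSurface where
  Side := Q × Bool × Fin 3
  next := coverNext Q
  glue := coverGlue x
  finite := inferInstance
  nonempty := ⟨(1, true, 0)⟩
  next_next_next := by
    rintro ⟨h, c, i⟩
    cases c <;> fin_cases i <;> simp [coverNext] <;> rfl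
  next_ne := by
    rintro ⟨h, c, i⟩
    cases c <;> fin_cases i <;> simp [coverNext]
  glue_glue := by rintro ⟨h, c, i⟩; cases c <;> simp [coverGlue]
  glue_ne := by rintro ⟨h, c, i⟩; cases c <;> simp [coverGlue]
  connected := cover_connected x hprod hgen

/-! ### The groups `G_k` -/

/-- The group `⟨x_0, …, x_6 | x_i x_{i+1} x_{i+3}, i = 0, …, 6⟩`, indices modulo `7`. -/
abbrev BuildingGroup : Type :=
  PresentedGroup (Set.range fun i : Fin 7 =>
    FreeGroup.of i * FreeGroup.of (i + 1) * FreeGroup.of (i + 3))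

/-- The generators `x_i`. -/
def buildingGen (i : Fin 7) : BuildingGroup := PresentedGroup.of i

/-- The subgroup `G` generated by `x_0, x_1, x_3`. -/
def groupG : Subgroup BuildingGroup :=
  Subgroup.closure {buildingGen 0, buildingGen 1, buildingGen 3}

/-- The `3 × 3` matrices over the field with two elements. -/
abbrev Block : Type := Matrix (Fin 3) (Fin 3) (ZMod 2)

/-- The ring of all infinite upper triangular matrices, with rows and columns numbered by `ℕ`, whose
entries are `3 × 3` matrices over the field with two elements. -/
abbrev UpperTriangular : Type := IncidenceAlgebra Block ℕ

/-- The infinite upper triangular matrix with `3`-periodic diagonals whose entry in the row `i` of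
the `d`-th upper diagonal is `c d (i % 3)`. -/
def toeplitz (c : ℕ → ℕ → Block) : UpperTriangular where
  toFun i j := if i ≤ j then c (j - i) (i % 3) else 0
  eq_zero_of_not_le' _ _ h := if_neg h

theorem toeplitz_mul (c c' : ℕ → ℕ → Block) :
    toeplitz c * toeplitz c' = toeplitz fun d r =>
      ∑ p ∈ Finset.range (d + 1), c p r * c' (d - p) ((r + p) % 3) := by
  ext1 i j hij
  rw [IncidenceAlgebra.mul_apply]
  change _ = if i ≤ j then _ else _
  rw [if_pos hij]
  obtain ⟨d, rfl⟩ := Nat.exists_eq_add_of_le hij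
  have hI : Finset.Icc i (i + d) = Finset.Ico i (i + (d + 1)) := by
    ext k; simp only [Finset.mem_Icc, Finset.mem_Ico]; omega
  rw [hI, Finset.sum_Ico_eq_sum_range, Nat.add_sub_cancel_left, Nat.add_sub_cancel_left]
  refine Finset.sum_congr rfl fun p hp => ?_
  rw [Finset.mem_range] at hp
  change (if i ≤ i + p then _ else _) * (if i + p ≤ i + d then _ else _) = _
  rw [if_pos (by omega), if_pos (by omega), Nat.add_sub_cancel_left, Nat.add_sub_add_left,
    Nat.mod_add_mod]

/-- A product of two banded matrices with periodic diagonals is determined by finitely many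
entries. -/
theorem toeplitz_mul_eq (c c' e : ℕ → ℕ → Block) (a b : ℕ)
    (hc : ∀ d r, a < d → c d r = 0) (hc' : ∀ d r, b < d → c' d r = 0)
    (he : ∀ d r, a + b < d → e d r = 0)
    (h : ∀ d ≤ a + b, ∀ r < 3,
      ∑ p ∈ Finset.range (d + 1), c p r * c' (d - p) ((r + p) % 3) = e d r) :
    toeplitz c * toeplitz c' = toeplitz e := by
  rw [toeplitz_mul]
  ext1 i j hij
  change (if i ≤ j then _ else _) = if i ≤ j then _ else _
  rw [if_pos hij, if_pos hij]
  by_cases hd : j - i ≤ a + b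
  · exact h _ hd _ (Nat.mod_lt _ (by norm_num))
  · push Not at hd
    rw [he _ _ hd]
    refine Finset.sum_eq_zero fun p hp => ?_
    by_cases hp' : a < p
    · rw [hc _ _ hp', zero_mul]
    · rw [hc' _ _ (by omega), mul_zero]

/-- The pattern of the identity matrix. -/
def patOne : ℕ → ℕ → Block := fun d _ => if d = 0 then 1 else 0

theorem toeplitz_patOne : toeplitz patOne = 1 := by
  ext1 i j hij
  change (if i ≤ j then (if j - i = 0 then (1 : Block) else 0) else 0) = _
  rw [if_pos hij, IncidenceAlgebra.one_apply]
  congr 1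
  exact propext ⟨fun h => by omega, fun h => by omega⟩

/-- The block of the first upper diagonal of the matrix of `x_0`. -/
def blkA : Block := !![0, 0, 0; 0, 0, 1; 0, 1, 1]

/-- The block of the second upper diagonal of the matrix of `x_0`. -/
def blkB : Block := !![0, 0, 0; 0, 1, 0; 0, 0, 1]

/-- The block of the third upper diagonal of the matrix of `x_0`. -/
def blkC : Block := !![0, 0, 0; 0, 1, 1; 0, 1, 0]

/-- The block of the matrix of the rotation that permutes the generators `x_i`. -/
def blkU : Block := !![0, 0, 1; 1, 0, 1; 0, 1, 0]

/-- The diagonals of the matrix of `x_0`: the entry number `r` in the list for `d` is repeated in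
the rows `r, r + 3, r + 6, …` of the `d`-th upper diagonal. -/
def patX : ℕ → ℕ → Block
  | 0, _ => 1
  | 1, _ => blkA
  | 2, _ => blkB
  | 3, _ => blkC
  | 4, 0 => blkA
  | 4, 1 => blkA
  | 5, 0 => blkB
  | _, _ => 0

/-- The diagonals of the inverse of the matrix of `x_0`. -/
def patXInv : ℕ → ℕ → Block
  | 0, _ => 1
  | 1, _ => blkA
  | 2, _ => blkA
  | 3, _ => blkA
  | 4, 0 => blkA
  | 4, 1 => blkA
  | 5, 0 => blkA
  | _, _ => 0

/-- The pattern of a block diagonal matrix with the diagonal `1, u, v, 1, u, v, …`. -/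
def patDiag (u v : Block) : ℕ → ℕ → Block
  | 0, 0 => 1
  | 0, 1 => u
  | 0, 2 => v
  | _, _ => 0

theorem patX_zero (d r : ℕ) (hd : 5 < d) : patX d r = 0 :=
  match d, hd with
  | _ + 6, _ => rfl

theorem patXInv_zero (d r : ℕ) (hd : 5 < d) : patXInv d r = 0 :=
  match d, hd with
  | _ + 6, _ => rfl

theorem patDiag_zero (u v : Block) (d r : ℕ) (hd : 0 < d) : patDiag u v d r = 0 :=
  match d, hd with
  | _ + 1, _ => rfl

theorem patOne_zero (d r : ℕ) (hd : 0 < d) : patOne d r = 0 := if_neg (by omega)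

/-- The matrix of `x_0`, an invertible matrix. -/
def matX : UpperTriangularˣ where
  val := toeplitz patX
  inv := toeplitz patXInv
  val_inv := by
    rw [← toeplitz_patOne]
    exact toeplitz_mul_eq _ _ _ 5 5 patX_zero patXInv_zero
      (fun d r hd => patOne_zero d r (by omega)) (by decide +kernel)
  inv_val := by
    rw [← toeplitz_patOne]
    exact toeplitz_mul_eq _ _ _ 5 5 patXInv_zero patX_zero
      (fun d r hd => patOne_zero d r (by omega)) (by decide +kernel)

/-- The block diagonal matrix that permutes the generators `x_i` by conjugation. -/
def matU : UpperTriangularˣ where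
  val := toeplitz (patDiag blkU (blkU ^ 3))
  inv := toeplitz (patDiag (blkU ^ 6) (blkU ^ 4))
  val_inv := by
    rw [← toeplitz_patOne]
    exact toeplitz_mul_eq _ _ _ 0 0 (patDiag_zero _ _) (patDiag_zero _ _) patOne_zero
      (by decide +kernel)
  inv_val := by
    rw [← toeplitz_patOne]
    exact toeplitz_mul_eq _ _ _ 0 0 (patDiag_zero _ _) (patDiag_zero _ _) patOne_zero
      (by decide +kernel)

/-- The matrix of the generator `x_i`, for `i = 0, …, 6`.

These are the matrices of the representation of the group `G` of Peyerimhoff and Vdovina.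
In terms of the field `F` with eight elements, of an element `u` of `F` with `u ^ 3 = u + 1`,
and of the skew power series ring `F⟦π⟧` with `π a = a ^ 2 π`, the matrix of `x_i` describes the
conjugation `y ↦ g⁻¹ y g` by `g = 1 + u ^ i π` (row vectors, basis `1, u ^ 2, u` of `F`, and `π ^ j t ^ n` with
`j = 0, 1, 2` and `t = π ^ 3 / (1 + π ^ 3)`), and `matU` describes the conjugation by `u`.
The first upper diagonals are computed in `matGen_firstDiagonal`. -/
def matGen (i : ℕ) : UpperTriangularˣ := (matU ^ i)⁻¹ * matX * matU ^ i

theorem diag_mul (u v : Block) (c : ℕ → ℕ → Block) :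
    toeplitz (patDiag u v) * toeplitz c = toeplitz fun d r => patDiag u v 0 r * c d (r % 3) := by
  rw [toeplitz_mul]
  congr 1
  funext d r
  rw [Finset.sum_eq_single_of_mem 0 (by simp)
    (fun p _ hp => by rw [patDiag_zero _ _ _ _ (by omega), zero_mul])]
  rfl

theorem mul_diag (u v : Block) (c : ℕ → ℕ → Block) :
    toeplitz c * toeplitz (patDiag u v) =
      toeplitz fun d r => c d r * patDiag u v 0 ((r + d) % 3) := by
  rw [toeplitz_mul]
  congr 1
  funext d r
  rw [Finset.sum_eq_single_of_mem d (by simp) (fun p hp hp' => by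
    rw [Finset.mem_range] at hp
    rw [patDiag_zero _ _ _ _ (by omega), mul_zero]), Nat.sub_self]

theorem matU_pow_val (n : ℕ) :
    (matU ^ n : UpperTriangularˣ).val = toeplitz (patDiag (blkU ^ n) (blkU ^ (3 * n))) := by
  induction n with
  | zero =>
    rw [pow_zero, Units.val_one, ← toeplitz_patOne]
    ext1 i j hij
    change (if i ≤ j then patOne (j - i) (i % 3) else 0) = if i ≤ j then _ else 0
    congr 1
    rcases Nat.eq_zero_or_pos (j - i) with h | h
    · rw [h]
      have := Nat.mod_lt i (show 3 > 0 by norm_num)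
      interval_cases i % 3 <;> rfl
    · rw [patOne_zero _ _ h, patDiag_zero _ _ _ _ h]
  | succ n ih =>
    rw [pow_succ, Units.val_mul, ih]
    refine toeplitz_mul_eq _ _ _ 0 0 (patDiag_zero _ _) (patDiag_zero _ _) (patDiag_zero _ _) ?_
    intro d hd r hr
    obtain rfl : d = 0 := by omega
    interval_cases r
    · simp [patDiag]
    · simp [patDiag, pow_succ]
    · simp [patDiag, mul_add, pow_add]

theorem matU_pow_seven : matU ^ 7 = 1 := by
  have h : matU ^ 6 = matU⁻¹ := by
    ext1
    rw [matU_pow_val]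
    have : blkU ^ (3 * 6) = blkU ^ 4 := by decide +kernel
    rw [this]
    rfl
  rw [show 7 = 6 + 1 from rfl, pow_succ, h, inv_mul_cancel]

theorem matGen_val (i : ℕ) : (matGen i).val = toeplitz fun d r =>
    patDiag (blkU ^ (6 * i)) (blkU ^ (3 * (6 * i))) 0 r * patX d (r % 3) *
      patDiag (blkU ^ i) (blkU ^ (3 * i)) 0 ((r + d) % 3) := by
  have h : (matU ^ i)⁻¹ = matU ^ (6 * i) := by
    rw [inv_eq_iff_mul_eq_one, ← pow_add, show i + 6 * i = 7 * i by ring, pow_mul,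
      matU_pow_seven, one_pow]
  rw [matGen, h, Units.val_mul, Units.val_mul, matU_pow_val, matU_pow_val]
  change toeplitz _ * toeplitz patX * toeplitz _ = _
  rw [diag_mul, mul_diag]

/-- The blocks of the first upper diagonals of the matrices of `x_0`, `x_1` and `x_3`. -/
theorem matGen_firstDiagonal :
    (∀ r < 3, (matGen 0).val r (r + 1) =
      ![!![0, 0, 0; 0, 0, 1; 0, 1, 1], !![0, 0, 0; 0, 0, 1; 0, 1, 1],
        !![0, 0, 0; 0, 0, 1; 0, 1, 1]] (Fin.ofNat 3 r)) ∧
    (∀ r < 3, (matGen 1).val r (r + 1) =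
      ![!![0, 0, 0; 0, 1, 0; 1, 1, 1], !![0, 1, 1; 1, 0, 0; 0, 0, 0],
        !![0, 1, 0; 0, 0, 1; 0, 1, 0]] (Fin.ofNat 3 r)) ∧
    (∀ r < 3, (matGen 3).val r (r + 1) =
      ![!![0, 0, 0; 0, 1, 1; 1, 0, 0], !![0, 1, 1; 1, 0, 1; 0, 1, 1],
        !![0, 1, 0; 0, 0, 0; 0, 0, 1]] (Fin.ofNat 3 r)) := by
  simp only [matGen_val]
  decide +kernel

theorem matGen_mod (i : ℕ) : matGen (i % 7) = matGen i := by
  rw [matGen, matGen, ← pow_eq_pow_mod i matU_pow_seven]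

theorem matGen_rel_zero : matGen 0 * matGen 1 * matGen 3 = 1 := by
  have h1 : (matX * matU⁻¹ : UpperTriangularˣ).val = toeplitz fun d r =>
      patX d r * patDiag (blkU ^ 6) (blkU ^ 4) 0 ((r + d) % 3) :=
    toeplitz_mul_eq _ _ _ 5 0 patX_zero (patDiag_zero _ _)
      (fun d r hd => by rw [patX_zero d r hd, zero_mul]) (by decide +kernel)
  have h2 : (matX * matU⁻¹ * matU⁻¹ : UpperTriangularˣ).val = toeplitz fun d r =>
      patX d r * patDiag (blkU ^ 5) (blkU ^ 1) 0 ((r + d) % 3) := by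
    rw [Units.val_mul, h1]
    exact toeplitz_mul_eq _ _ _ 5 0
      (fun d r hd => by rw [patX_zero d r hd, zero_mul]) (patDiag_zero _ _)
      (fun d r hd => by rw [patX_zero d r hd, zero_mul]) (by decide +kernel)
  have h3 : (matU⁻¹ * matX⁻¹ : UpperTriangularˣ).val = toeplitz fun d r =>
      patDiag (blkU ^ 6) (blkU ^ 4) 0 (r % 3) * patXInv d r :=
    toeplitz_mul_eq _ _ _ 0 5 (patDiag_zero _ _) patXInv_zero
      (fun d r hd => by rw [patXInv_zero d r (by omega), mul_zero]) (by decide +kernel)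
  have h4 : (matU⁻¹ * (matU⁻¹ * matX⁻¹) : UpperTriangularˣ).val = toeplitz fun d r =>
      patDiag (blkU ^ 5) (blkU ^ 1) 0 (r % 3) * patXInv d r := by
    rw [Units.val_mul, h3]
    exact toeplitz_mul_eq _ _ _ 0 5 (patDiag_zero _ _)
      (fun d r hd => by rw [patXInv_zero d r (by omega), mul_zero])
      (fun d r hd => by rw [patXInv_zero d r (by omega), mul_zero]) (by decide +kernel)
  have h5 : (matU⁻¹ * (matU⁻¹ * (matU⁻¹ * matX⁻¹)) : UpperTriangularˣ).val = toeplitz fun d r =>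
      patDiag (blkU ^ 4) (blkU ^ 5) 0 (r % 3) * patXInv d r := by
    rw [Units.val_mul, h4]
    exact toeplitz_mul_eq _ _ _ 0 5 (patDiag_zero _ _)
      (fun d r hd => by rw [patXInv_zero d r (by omega), mul_zero])
      (fun d r hd => by rw [patXInv_zero d r (by omega), mul_zero]) (by decide +kernel)
  have h6 : (matX * matU⁻¹) * (matX * matU⁻¹ * matU⁻¹) =
      matU⁻¹ * (matU⁻¹ * (matU⁻¹ * matX⁻¹)) := by
    ext1
    rw [Units.val_mul, h1, h2, h5]
    exact toeplitz_mul_eq _ _ _ 5 5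
      (fun d r hd => by rw [patX_zero d r hd, zero_mul])
      (fun d r hd => by rw [patX_zero d r hd, zero_mul])
      (fun d r hd => by rw [patXInv_zero d r (by omega), mul_zero]) (by decide +kernel)
  have h7 : matGen 0 * matGen 1 * matGen 3 =
      ((matX * matU⁻¹) * (matX * matU⁻¹ * matU⁻¹)) * (matX * matU ^ 3) := by
    simp only [matGen]
    group
  rw [h7, h6]
  group

theorem matGen_rel (i : ℕ) : matGen i * matGen (i + 1) * matGen (i + 3) = 1 := by
  have h : matGen i * matGen (i + 1) * matGen (i + 3) =
      (matU ^ i)⁻¹ * (matGen 0 * matGen 1 * matGen 3) * matU ^ i := by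
    simp only [matGen]
    group
  rw [h, matGen_rel_zero]
  group

/-- The shift of an upper triangular matrix by three rows and three columns. -/
def shift : UpperTriangular →+* UpperTriangular where
  toFun A :=
    { toFun := fun i j => A (i + 3) (j + 3)
      eq_zero_of_not_le' := fun i j h => A.apply_eq_zero_of_not_le (by omega) }
  map_one' := by
    ext1 i j _
    change (1 : UpperTriangular) (i + 3) (j + 3) = (1 : UpperTriangular) i j
    simp only [IncidenceAlgebra.one_apply, Nat.add_right_cancel_iff]
  map_zero' := rfl
  map_add' _ _ := rfl
  map_mul' A B := by
    ext1 i j _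
    change (A * B) (i + 3) (j + 3) = ∑ k ∈ Finset.Icc i j, A (i + 3) (k + 3) * B (k + 3) (j + 3)
    rw [IncidenceAlgebra.mul_apply, ← Finset.map_add_right_Icc, Finset.sum_map]
    rfl

theorem mul_apply_self (A B : UpperTriangular) (i : ℕ) : (A * B) i i = A i i * B i i := by
  rw [IncidenceAlgebra.mul_apply, Finset.Icc_self, Finset.sum_singleton]

/-- The group `H` of the infinite upper triangular matrices with `3`-periodic diagonals (Toeplitz
matrices with periodic patterns) whose diagonal entries are `1`. -/
def toeplitzGroup : Subgroup UpperTriangularˣ where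
  carrier := {A | (∀ i, A.val i i = 1) ∧ ∀ i j, A.val (i + 3) (j + 3) = A.val i j}
  one_mem' := by
    refine ⟨fun i => ?_, fun i j => ?_⟩
    · simp [IncidenceAlgebra.one_apply]
    · simp [IncidenceAlgebra.one_apply]
  mul_mem' := by
    rintro A B ⟨hA, hA'⟩ ⟨hB, hB'⟩
    refine ⟨fun i => ?_, fun i j => ?_⟩
    · rw [Units.val_mul, mul_apply_self, hA, hB, one_mul]
    · have eA : shift A.val = A.val := by ext1 i j _; exact hA' i j
      have eB : shift B.val = B.val := by ext1 i j _; exact hB' i j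
      change shift (A.val * B.val) i j = (A.val * B.val) i j
      rw [map_mul, eA, eB]
  inv_mem' := by
    rintro A ⟨hA, hA'⟩
    refine ⟨fun i => ?_, fun i j => ?_⟩
    · have h := mul_apply_self A.val A⁻¹.val i
      rw [Units.mul_inv, hA, one_mul] at h
      rw [← h]
      simp [IncidenceAlgebra.one_apply]
    · have eA : Units.map (shift : UpperTriangular →* UpperTriangular) A = A := by
        ext1; ext1 i j _; exact hA' i j
      have eA' := congrArg (fun u : UpperTriangularˣ => u⁻¹) eA
      simp only [← map_inv] at eA'
      exact congrArg (fun u : UpperTriangularˣ => u.val i j) eA'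

/-- The first `k` upper diagonals and the main diagonal of `A` vanish. -/
def DiagonalsVanish (k : ℕ) (A : UpperTriangular) : Prop := ∀ i j, j ≤ i + k → A i j = 0

theorem DiagonalsVanish.mul_left {k : ℕ} {A : UpperTriangular} (h : DiagonalsVanish k A)
    (B : UpperTriangular) : DiagonalsVanish k (B * A) := by
  intro i j hij
  rw [IncidenceAlgebra.mul_apply]
  refine Finset.sum_eq_zero fun l hl => ?_
  rw [Finset.mem_Icc] at hl
  rw [h l j (by omega), mul_zero]

theorem DiagonalsVanish.mul_right {k : ℕ} {A : UpperTriangular} (h : DiagonalsVanish k A)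
    (B : UpperTriangular) : DiagonalsVanish k (A * B) := by
  intro i j hij
  rw [IncidenceAlgebra.mul_apply]
  refine Finset.sum_eq_zero fun l hl => ?_
  rw [Finset.mem_Icc] at hl
  rw [h i l (by omega), zero_mul]

theorem diagonalsVanish_sub_one (k : ℕ) (A : toeplitzGroup) :
    DiagonalsVanish k (A.1.val - 1) ↔ ∀ i j, i < j → j ≤ i + k → A.1.val i j = 0 := by
  constructor
  · intro h i j hij hk
    have := h i j hk
    rwa [IncidenceAlgebra.sub_apply, IncidenceAlgebra.one_apply, if_neg hij.ne, sub_zero] at this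
  · intro h i j hk
    rw [IncidenceAlgebra.sub_apply, IncidenceAlgebra.one_apply]
    rcases lt_trichotomy i j with hij | rfl | hij
    · rw [h i j hij hk, if_neg hij.ne, sub_zero]
    · rw [A.2.1, if_pos rfl, sub_self]
    · rw [IncidenceAlgebra.apply_eq_zero_of_not_le (by omega), if_neg hij.ne', sub_zero]

/-- The subgroup `H_k` of the matrices in `H` whose first `k` upper diagonals are zero. -/
def toeplitzCongruence (k : ℕ) : Subgroup toeplitzGroup where
  carrier := {A | ∀ i j, i < j → j ≤ i + k → A.1.val i j = 0}
  one_mem' := by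
    rw [Set.mem_ofPred_eq, ← diagonalsVanish_sub_one]
    intro i j _
    change ((1 : UpperTriangular) - 1) i j = 0
    rw [sub_self]
    rfl
  mul_mem' := by
    intro A B hA hB
    rw [Set.mem_ofPred_eq, ← diagonalsVanish_sub_one] at hA hB ⊢
    have h : (A * B).1.val - 1 = (A.1.val - 1) * B.1.val + (B.1.val - 1) := by
      rw [sub_mul, one_mul, sub_add_sub_cancel]
      rfl
    rw [h]
    intro i j hij
    rw [IncidenceAlgebra.add_apply, hA.mul_right _ i j hij, hB i j hij, add_zero]
  inv_mem' := by
    intro A hA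
    rw [Set.mem_ofPred_eq, ← diagonalsVanish_sub_one] at hA ⊢
    have h : (A⁻¹).1.val - 1 = -((A⁻¹).1.val * (A.1.val - 1)) := by
      rw [mul_sub, mul_one, neg_sub]
      change _ = _ - (A.1⁻¹).val * A.1.val
      rw [Units.inv_mul]
    rw [h]
    intro i j hij
    rw [IncidenceAlgebra.neg_apply, hA.mul_left _ i j hij, neg_zero]

instance toeplitzCongruence_normal (k : ℕ) : (toeplitzCongruence k).Normal where
  conj_mem := by
    intro A hA B
    change ∀ i j, i < j → j ≤ i + k → A.1.val i j = 0 at hA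
    change ∀ i j, i < j → j ≤ i + k → (B * A * B⁻¹).1.val i j = 0
    rw [← diagonalsVanish_sub_one] at hA ⊢
    have h : (B * A * B⁻¹).1.val - 1 = B.1.val * (A.1.val - 1) * (B⁻¹).1.val := by
      rw [mul_sub, sub_mul, mul_one]
      change _ = _ - B.1.val * (B.1⁻¹).val
      rw [Units.mul_inv]
      rfl
    rw [h]
    exact (hA.mul_left _).mul_right _

/-- Only finitely many entries of a matrix in `H` matter modulo `H_k`. -/
theorem toeplitz_quotient_finite (k : ℕ) : Finite (toeplitzGroup ⧸ toeplitzCongruence k) := by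
  let f : toeplitzGroup → (Fin 3 → Fin (k + 1) → Block) :=
    fun A r d => A.1.val r (r + d)
  have hf : ∀ A B, f A = f B → (A : toeplitzGroup ⧸ toeplitzCongruence k) = B := by
    intro A B hAB
    have hper : ∀ (C : toeplitzGroup) (r d n : ℕ), C.1.val (r + 3 * n) (r + 3 * n + d) =
        C.1.val r (r + d) := by
      intro C r d n
      induction n with
      | zero => rfl
      | succ n ih =>
        rw [show r + 3 * (n + 1) = r + 3 * n + 3 by ring,
          show r + 3 * n + 3 + d = r + 3 * n + d + 3 by ring, C.2.2, ih]
    have hd : DiagonalsVanish k (B.1.val - A.1.val) := by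
      intro i j hij
      rw [IncidenceAlgebra.sub_apply, sub_eq_zero]
      by_cases h : i ≤ j
      · obtain ⟨d, rfl⟩ := Nat.exists_eq_add_of_le h
        have e := Nat.mod_add_div i 3
        have h1 := hper A (i % 3) d (i / 3)
        have h2 := hper B (i % 3) d (i / 3)
        rw [e] at h1 h2
        rw [h1, h2]
        exact (congrFun (congrFun hAB ⟨i % 3, Nat.mod_lt _ (by norm_num)⟩) ⟨d, by omega⟩).symm
      · rw [IncidenceAlgebra.apply_eq_zero_of_not_le h, IncidenceAlgebra.apply_eq_zero_of_not_le h]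
    rw [QuotientGroup.eq]
    change ∀ i j, i < j → j ≤ i + k → (A⁻¹ * B).1.val i j = 0
    rw [← diagonalsVanish_sub_one]
    have h : (A⁻¹ * B).1.val - 1 = (A⁻¹).1.val * (B.1.val - A.1.val) := by
      rw [mul_sub]
      change _ = _ - (A.1⁻¹).val * A.1.val
      rw [Units.inv_mul]
      rfl
    rw [h]
    exact hd.mul_left _
  have : Finite (Set.range f) := inferInstance
  refine Finite.of_surjective
    (fun y : Set.range f => ((y.2.choose : toeplitzGroup) : toeplitzGroup ⧸ toeplitzCongruence k))
    ?_
  intro q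
  obtain ⟨A, rfl⟩ := QuotientGroup.mk_surjective q
  refine ⟨⟨f A, A, rfl⟩, ?_⟩
  exact hf _ _ (Exists.choose_spec (⟨A, rfl⟩ : ∃ B, f B = f A))

theorem matGen_mem (i : ℕ) : matGen i ∈ toeplitzGroup := by
  refine ⟨fun r => ?_, fun r s => ?_⟩
  · rw [matGen, Units.val_mul, Units.val_mul, mul_apply_self, mul_apply_self]
    have hX : matX.val r r = 1 := by
      change (if r ≤ r then patX (r - r) (r % 3) else 0) = 1
      rw [if_pos le_rfl, Nat.sub_self]
      rfl
    rw [hX, mul_one, ← mul_apply_self, Units.inv_mul, IncidenceAlgebra.one_apply, if_pos rfl]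
  · rw [matGen_val]
    change (if r + 3 ≤ s + 3 then _ else _) = if r ≤ s then _ else _
    rw [Nat.add_sub_add_right, Nat.add_mod_right]
    simp only [Nat.add_le_add_iff_right]

/-- The matrices of the generators, as elements of `H`. -/
def toeplitzGen (i : ℕ) : toeplitzGroup := ⟨matGen i, matGen_mem i⟩

/-- The representation of the group `⟨x_0, …, x_6 | x_i x_{i+1} x_{i+3}⟩` by infinite upper
triangular matrices. -/
def toeplitzRep : BuildingGroup →* toeplitzGroup :=
  PresentedGroup.toGroup (f := fun i : Fin 7 => toeplitzGen i) (by
    rintro _ ⟨i, rfl⟩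
    rw [map_mul, map_mul, FreeGroup.lift_apply_of, FreeGroup.lift_apply_of,
      FreeGroup.lift_apply_of]
    ext1
    change matGen i * matGen ((i + 1 : Fin 7) : ℕ) * matGen ((i + 3 : Fin 7) : ℕ) = 1
    rw [Fin.val_add, Fin.val_add, matGen_mod, matGen_mod]
    exact matGen_rel i)

/-- The subgroup `G ∩ H_k` of `G`. -/
def congruenceG (k : ℕ) : Subgroup groupG :=
  (toeplitzCongruence k).comap (toeplitzRep.comp groupG.subtype)

instance congruenceG_normal (k : ℕ) : (congruenceG k).Normal :=
  Subgroup.Normal.comap inferInstance _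

/-- The finite group `G_k = G / (G ∩ H_k)`. -/
abbrev GroupGk (k : ℕ) : Type := groupG ⧸ congruenceG k

theorem groupGk_finite (k : ℕ) : Finite (GroupGk k) := by
  have := toeplitz_quotient_finite k
  have h : Function.Injective (QuotientGroup.map (congruenceG k) (toeplitzCongruence k)
      (toeplitzRep.comp groupG.subtype)
      (show congruenceG k ≤ (toeplitzCongruence k).comap (toeplitzRep.comp groupG.subtype) from
        le_refl _)) := by
    rw [← MonoidHom.ker_eq_bot_iff, eq_bot_iff]
    intro q hq
    obtain ⟨g, rfl⟩ := QuotientGroup.mk_surjective q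
    rw [MonoidHom.mem_ker] at hq
    change ((toeplitzRep.comp groupG.subtype g : toeplitzGroup) :
      toeplitzGroup ⧸ toeplitzCongruence k) = 1 at hq
    rw [QuotientGroup.eq_one_iff] at hq
    rw [Subgroup.mem_bot, QuotientGroup.eq_one_iff]
    exact hq
  exact Finite.of_injective _ h

/-- The generators `x_0, x_1, x_3` of `G`. -/
def genG : Fin 3 → groupG :=
  ![⟨buildingGen 0, Subgroup.subset_closure (by simp)⟩,
    ⟨buildingGen 1, Subgroup.subset_closure (by simp)⟩,
    ⟨buildingGen 3, Subgroup.subset_closure (by simp)⟩]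

/-- The images of `x_0, x_1, x_3` in `G_k`. -/
def genGk (k : ℕ) (i : Fin 3) : GroupGk k := (genG i : GroupGk k)

theorem genGk_prod (k : ℕ) : genGk k 0 * genGk k 1 * genGk k 2 = 1 := by
  have h : genG 0 * genG 1 * genG 2 = 1 := by
    ext1
    exact PresentedGroup.one_of_mem (rels := Set.range fun i : Fin 7 =>
      FreeGroup.of i * FreeGroup.of (i + 1) * FreeGroup.of (i + 3)) ⟨0, rfl⟩
  change ((genG 0 * genG 1 * genG 2 : groupG) : GroupGk k) = 1
  rw [h]
  rfl

theorem genGk_closure (k : ℕ) : Subgroup.closure (Set.range (genGk k)) = ⊤ := by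
  have h : Subgroup.closure (Set.range genG) = ⊤ := by
    have h1 : Subgroup.closure ((Subtype.val : groupG → BuildingGroup) ⁻¹'
        {buildingGen 0, buildingGen 1, buildingGen 3}) = ⊤ :=
      Subgroup.closure_closure_coe_preimage
    rw [eq_top_iff, ← h1, Subgroup.closure_le]
    rintro ⟨x, hx⟩ hx'
    rcases hx' with h | h | h
    · exact Subgroup.subset_closure ⟨0, Subtype.ext h.symm⟩
    · exact Subgroup.subset_closure ⟨1, Subtype.ext h.symm⟩
    · exact Subgroup.subset_closure ⟨2, Subtype.ext h.symm⟩
  have h2 := congrArg (Subgroup.map (QuotientGroup.mk' (congruenceG k))) h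
  rw [MonoidHom.map_closure, ← Set.range_comp, Subgroup.map_top_of_surjective _
    (QuotientGroup.mk'_surjective _)] at h2
  exact h2

/-! ### The graphs `X_k`, `T_k` and the surface of `T_k` -/

/-- The Cayley graph `X_k` of `G_k` with respect to `x_0^{±1}, x_1^{±1}, x_3^{±1}`. -/
def graphX (k : ℕ) : SimpleGraph (GroupGk k) :=
  SimpleGraph.mulCayley (Set.range (genGk k) ∪ (Set.range (genGk k))⁻¹)

/-- The `Δ-Y`-transformation of a graph in all its triangles: every triangle becomes a new vertex,
which is joined to the three vertices of the triangle, and the edges of the triangles are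
removed. -/
def deltaY {V : Type} (X : SimpleGraph V) :
    SimpleGraph (V ⊕ {t : Finset V // X.IsNClique 3 t}) where
  Adj
    | .inl v, .inl w => X.Adj v w ∧ ¬ ∃ t : Finset V, X.IsNClique 3 t ∧ v ∈ t ∧ w ∈ t
    | .inl v, .inr t => v ∈ t.1
    | .inr t, .inl v => v ∈ t.1
    | .inr _, .inr _ => False
  symm := ⟨by
    rintro (v | t) (w | t') h
    · exact ⟨h.1.symm, fun ⟨t, ht, hw, hv⟩ => h.2 ⟨t, ht, hv, hw⟩⟩
    · exact h
    · exact h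
    · exact h⟩
  loopless := ⟨by
    rintro (v | t) h
    · exact X.irrefl h.1
    · exact h⟩

/-- The graph `T_k`, the `Δ-Y`-transformation of `X_k`. -/
def graphT (k : ℕ) :
    SimpleGraph (GroupGk k ⊕ {t : Finset (GroupGk k) // (graphX k).IsNClique 3 t}) :=
  deltaY (graphX k)

/-- The surface of `T_k` with its triangulation `T_k^*` by black and white triangles. -/
def surfaceT (k : ℕ) : TriangulatedSurface :=
  coveringSurface (GroupGk k) (genGk k) (groupGk_finite k) (genGk_prod k) (genGk_closure k)

/-! Both limits come from Euler's formula. In a closed triangulated surface $3F=2E$, so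
$6g=6-3\chi=E+6-3V$ and $6g/E-1=(6-3V)/E$. If every vertex has degree at least $L$, then $LV\le 2E$,
and the error is at most $18/L$ (`abs_six_mul_genus_div_sub_one_le`). It remains to see that the
minimal degrees tend to infinity.

For $\mathcal S(\Pi_N)$ a step around a vertex is right multiplication by $T$, and $T^j\equiv\pm1$
modulo $N$ forces $N\mid j$ (`le_of_platonicSurface_pow_eq`). The edges of the surface are those of
$\Pi_N$, because matrices in $SL(2,\mathbb Z/N)$ up to sign are the directed edges of $\Pi_N$ and
all of them lift to $SL(2,\mathbb Z)$ (`sideDart_bijective`).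

For $\mathcal S(T_k)$ two steps around a vertex translate by a conjugate of an inverse generator. A
generator has order greater than $k$ in $G_k$: in characteristic $2$ one has
$X^{2^a}=1+(X-1)^{2^a}$, whose diagonal number $2^a$ is a nonzero power of the first diagonal block,
and an odd further exponent does not change that diagonal (`lt_of_diagonalsVanish_matX_pow`).

For the duality, black triangles correspond to elements of $G_k$ and white ones to triangles of
$X_k$. The second correspondence needs that, for $k\ge2$, the only relations of length three between
the $x_i^{\pm1}$ in $G_k$ are the obvious ones. This is a finite check on the first two diagonals
(`signed_triple`). -/

/-! ### Counting cycles of permutations -/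

section Cycles

variable {α : Type*} {σ : Equiv.Perm α} {L : ℕ}

/-- The points `σ ^ j a`, with `j < L` and `a` running through representatives of the cycles. -/
noncomputable def cyclePoint (σ : Equiv.Perm α) (L : ℕ)
    (p : Quotient (Equiv.Perm.SameCycle.setoid σ) × Fin L) : α :=
  (σ ^ (p.2 : ℕ)) p.1.out

/-- Points over different classes lie on different cycles. On one cycle, a coincidence at times `i <
j < L` would give the return time `j - i`, which is less than `L`. -/
theorem cyclePoint_injective (h : ∀ s j, 0 < j → (σ ^ j) s = s → L ≤ j) :
    Function.Injective (cyclePoint σ L) := by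
  have key : ∀ (a : α) (i j : Fin L), (σ ^ (i : ℕ)) a = (σ ^ (j : ℕ)) a → i ≤ j → i = j := by
    intro a i j hij hle
    by_contra hne
    have hlt : (i : ℕ) < j := lt_of_le_of_ne hle (fun e => hne (Fin.ext e))
    have := h a (j - i) (by omega) (by
      apply (σ ^ (i : ℕ)).injective
      rw [← Equiv.Perm.mul_apply, ← pow_add, Nat.add_sub_cancel' hlt.le, hij])
    omega
  rintro ⟨q, i⟩ ⟨q', j⟩ hp
  change (σ ^ (i : ℕ)) q.out = (σ ^ (j : ℕ)) q'.out at hp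
  have hq : q = q' := by
    rw [← q.out_eq, ← q'.out_eq]
    refine Quotient.sound ?_
    change σ.SameCycle _ _
    rw [← Equiv.Perm.sameCycle_pow_left (n := i), ← Equiv.Perm.sameCycle_pow_right (n := j), hp]
  subst hq
  refine Prod.ext rfl ?_
  rcases le_total i j with hle | hle
  · exact key _ _ _ hp hle
  · exact (key _ _ _ hp.symm hle).symm

/-- If all cycles have length at least `L`, then there are at most `|α| / L` cycles. -/
theorem mul_card_cycles_le [Finite α] (h : ∀ s j, 0 < j → (σ ^ j) s = s → L ≤ j) :
    L * Nat.card (Quotient (Equiv.Perm.SameCycle.setoid σ)) ≤ Nat.card α := by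
  have := Nat.card_le_card_of_injective _ (cyclePoint_injective h)
  rwa [Nat.card_prod, Nat.card_fin, mul_comm] at this

/-- If all cycles have length `L`, then there are `|α| / L` cycles. -/
theorem mul_card_cycles_eq [Finite α] (h : ∀ s j, 0 < j → (σ ^ j) s = s → L ≤ j)
    (hL : 0 < L) (h' : ∀ s, (σ ^ L) s = s) :
    L * Nat.card (Quotient (Equiv.Perm.SameCycle.setoid σ)) = Nat.card α := by
  have hs : Function.Surjective (cyclePoint σ L) := by
    intro a
    have hr : σ.SameCycle (Quotient.mk (Equiv.Perm.SameCycle.setoid σ) a).out a :=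
      Quotient.exact (s := Equiv.Perm.SameCycle.setoid σ) (Quotient.out_eq _)
    obtain ⟨n, hn⟩ := hr.exists_nat_pow_eq
    refine ⟨(Quotient.mk _ a, ⟨n % L, Nat.mod_lt _ hL⟩), ?_⟩
    have hone : σ ^ L = 1 := Equiv.ext h'
    change (σ ^ (n % L)) _ = a
    rw [← pow_eq_pow_mod n hone, hn]
  have := Nat.card_eq_of_bijective _ ⟨cyclePoint_injective h, hs⟩
  rwa [Nat.card_prod, Nat.card_fin, mul_comm] at this

end Cycles

/-! ### The genus of a triangulated surface with vertices of large degree -/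

namespace TriangulatedSurface

variable (S : TriangulatedSurface)

theorem two_mul_card_edge : 2 * Nat.card S.Edge = Nat.card S.Side := by
  have := S.finite
  refine mul_card_cycles_eq (fun s j hj hs => ?_) two_pos (fun s => ?_)
  · by_contra hlt
    obtain rfl : j = 1 := by omega
    exact S.glue_ne s (by simpa using hs)
  · rw [pow_two]; exact S.glue_glue s

theorem three_mul_card_face : 3 * Nat.card S.Face = Nat.card S.Side := by
  have := S.finite
  refine mul_card_cycles_eq (fun s j hj hs => ?_) three_pos (fun s => ?_)
  · by_contra hlt
    obtain rfl | rfl : j = 1 ∨ j = 2 := by omega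
    · exact S.next_ne s (by simpa using hs)
    -- A return after two steps, combined with the return after three, would be a return after one.
    · have h3 := S.next_next_next s
      rw [pow_two, Equiv.Perm.mul_apply] at hs
      rw [hs] at h3
      exact S.next_ne s h3
  · rw [pow_succ, pow_two]; exact S.next_next_next s

theorem six_mul_genus :
    6 * (S.genus : ℝ) = Nat.card S.Edge + 6 - 3 * Nat.card S.Vertex := by
  have h2 : (2 * Nat.card S.Edge : ℝ) = Nat.card S.Side := mod_cast S.two_mul_card_edge
  have h3 : (3 * Nat.card S.Face : ℝ) = Nat.card S.Side := mod_cast S.three_mul_card_face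
  rw [genus, eulerChar]
  push_cast
  linarith

/-- If every vertex has degree at least `L`, then `6 g / E` differs from `1` by at most `18 / L`. -/
theorem abs_six_mul_genus_div_sub_one_le {L : ℕ} (hL : 0 < L)
    (h : ∀ s j, 0 < j → ((S.next * S.glue) ^ j) s = s → L ≤ j) :
    |6 * (S.genus : ℝ) / Nat.card S.Edge - 1| ≤ 18 / L := by
  have := S.finite
  have : Nonempty S.Vertex := S.nonempty.map (Quotient.mk _)
  have hV : L * Nat.card S.Vertex ≤ Nat.card S.Side := mul_card_cycles_le h
  have hV1 : 0 < Nat.card S.Vertex := Nat.card_pos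
  rw [← S.two_mul_card_edge] at hV
  have hV' : (L * Nat.card S.Vertex : ℝ) ≤ 2 * Nat.card S.Edge := mod_cast hV
  have hV1' : (1 : ℝ) ≤ Nat.card S.Vertex := mod_cast hV1
  have hL' : (0 : ℝ) < L := mod_cast hL
  have hE : (0 : ℝ) < Nat.card S.Edge := by nlinarith
  rw [S.six_mul_genus, div_sub_one hE.ne', abs_div, abs_of_pos hE, div_le_div_iff₀ hE hL']
  -- As `1 ≤ V`, the term `6` is at most `6 * V`, so `|6 - 3 * V| ≤ 9 * V`; with `L * V ≤ 2 * E`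
  -- this gives the constant `18`.
  have : |(Nat.card S.Edge : ℝ) + 6 - 3 * Nat.card S.Vertex - Nat.card S.Edge| ≤
      9 * Nat.card S.Vertex := by
    rw [abs_le]
    constructor <;> linarith
  nlinarith

end TriangulatedSurface

/-- A sequence of surfaces whose minimal vertex degrees tend to infinity satisfies `6 g / E → 1`. -/
theorem tendsto_six_mul_genus_div (S : ℕ → TriangulatedSurface) (L : ℕ → ℕ)
    (hL : Tendsto L atTop atTop) (h0 : ∀ n, 0 < L n)
    (h : ∀ n s j, 0 < j → (((S n).next * (S n).glue) ^ j) s = s → L n ≤ j) :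
    Tendsto (fun n => 6 * ((S n).genus : ℝ) / Nat.card (S n).Edge) atTop (𝓝 1) := by
  rw [tendsto_iff_norm_sub_tendsto_zero]
  refine squeeze_zero (fun _ => norm_nonneg _)
    (fun n => (S n).abs_six_mul_genus_div_sub_one_le (h0 n) (h n)) ?_
  exact tendsto_const_nhds.div_atTop (tendsto_natCast_atTop_atTop.comp hL)

/-! ### The number of edges of the Platonic graphs -/

/-- A prime dividing `x.val`, `y.val` and `N` would turn the relation into `0 = 1` in `ZMod p`. -/
theorem gcd_val_eq_one {N : ℕ} [NeZero N] {x y z w : ZMod N} (h : z * x + w * y = 1) :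
    Nat.gcd (Nat.gcd x.val y.val) N = 1 := by
  rw [← Nat.coprime_iff_gcd_eq_one]
  refine Nat.coprime_of_dvd fun p hp hpg hpN => ?_
  have key : ∀ v : ZMod N, p ∣ v.val → ZMod.castHom hpN (ZMod p) v = 0 := by
    intro v hv
    rw [← ZMod.natCast_zmod_val v, map_natCast]
    exact (ZMod.natCast_eq_zero_iff _ _).mpr hv
  have h1 := congrArg (ZMod.castHom hpN (ZMod p)) h
  rw [map_add, map_mul, map_mul, key x (hpg.trans (Nat.gcd_dvd_left _ _)),
    key y (hpg.trans (Nat.gcd_dvd_right _ _)), map_one, mul_zero, mul_zero, add_zero] at h1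
  have : Fact (1 < p) := ⟨hp.one_lt⟩
  exact zero_ne_one h1

/-- Take for `k` the product of the primes that divide `d` but not `c`. A prime divisor of `d` then
divides exactly one of `c` and `k * N`: if it divides `c`, it divides neither `k` nor, by the gcd
condition, `N`. -/
theorem exists_coprime_add_mul {c d N : ℕ} (hd : d ≠ 0) (h : Nat.gcd (Nat.gcd c d) N = 1) :
    ∃ k, Nat.Coprime (c + k * N) d := by
  classical
  let ps : Finset ℕ := {p ∈ d.primeFactors | ¬p ∣ c}
  refine ⟨ps.prod id, Nat.coprime_of_dvd fun p pp hp hpd => ?_⟩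
  by_cases hpc : p ∣ c
  · rcases pp.dvd_mul.mp ((Nat.dvd_add_right hpc).mp hp) with h' | h'
    · obtain ⟨q, hq, hq'⟩ := (pp.prime.dvd_finsetProd_iff id).mp h'
      rw [Finset.mem_filter, Nat.mem_primeFactors] at hq
      obtain rfl := (Nat.prime_dvd_prime_iff_eq pp hq.1.1).mp hq'
      exact hq.2 hpc
    · have := Nat.dvd_gcd (Nat.dvd_gcd hpc hpd) h'
      rw [h] at this
      exact pp.one_lt.ne' (Nat.dvd_one.mp this)
  · have hps : p ∈ ps :=
      Finset.mem_filter.mpr ⟨Nat.mem_primeFactors.mpr ⟨pp, hpd, hd⟩, hpc⟩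
    exact hpc ((Nat.dvd_add_left ((Finset.dvd_prod_of_mem id hps).mul_right N)).mp hp)

/-- Reduction modulo `N` maps `SL(2, ℤ)` onto `SL(2, ℤ/N)`. -/
theorem specialLinearGroup_map_surjective (N : ℕ) [NeZero N] :
    Function.Surjective (Matrix.SpecialLinearGroup.map (Int.castRingHom (ZMod N)) :
      SL(2, ℤ) → SL(2, ZMod N)) := by
  intro g
  have hdet := g.det_coe
  rw [Matrix.det_fin_two] at hdet
  -- Adding `N` to the representative of the lower right entry makes it nonzero, as
  -- `exists_coprime_add_mul` requires.
  have hg : Nat.gcd (Nat.gcd (g 1 0).val ((g 1 1).val + N)) N = 1 := by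
    have h1 : Nat.gcd (Nat.gcd (g 1 0).val (g 1 1).val) N = 1 :=
      gcd_val_eq_one (z := -g 0 1) (w := g 0 0) (by linear_combination hdet)
    rw [Nat.gcd_assoc] at h1 ⊢
    rwa [Nat.gcd_add_self_left]
  obtain ⟨k, hk⟩ := exists_coprime_add_mul
    (by have := NeZero.pos N; omega) hg
  obtain ⟨γ, hγ0, hγ1⟩ := (Nat.isCoprime_iff_coprime.mpr hk).exists_SL2_row 1
  have e0 : ((γ 1 0 : ℤ) : ZMod N) = g 1 0 := by rw [hγ0]; simp
  have e1 : ((γ 1 1 : ℤ) : ZMod N) = g 1 1 := by rw [hγ1]; simp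
  have hγdet := congrArg (Int.cast : ℤ → ZMod N) γ.det_coe
  rw [Matrix.det_fin_two] at hγdet
  push_cast at hγdet
  rw [e0, e1] at hγdet
  -- Modulo `N`, `γ` has the same lower row as `g`, so `g * γ⁻¹` is unipotent upper triangular; `b`
  -- is its upper right entry.
  let b : ZMod N := g 0 1 * (γ 0 0 : ℤ) - g 0 0 * (γ 0 1 : ℤ)
  refine ⟨ModularGroup.T ^ (b.val : ℤ) * γ, ?_⟩
  ext i j
  rw [map_mul, Matrix.SpecialLinearGroup.coe_mul, Matrix.mul_apply, Fin.sum_univ_two]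
  simp only [Matrix.SpecialLinearGroup.map_apply_coe, RingHom.mapMatrix_apply, Matrix.map_apply,
    ModularGroup.coe_T_zpow]
  fin_cases i <;> fin_cases j
  · simp [e0, b]
    linear_combination (g 0 0) * hγdet - (γ 0 0 : ZMod N) * hdet
  · simp [e1, b]
    linear_combination (g 0 1) * hγdet - (γ 0 1 : ZMod N) * hdet
  · simp [e0]
  · simp [e1]

/-! ### Sides of the surface as directed edges of the Platonic graph. -/

section Platonic

variable {N : ℕ} [NeZero N]

/-- The vertices of the Platonic graph given by the two columns of a matrix in `SL(2, ℤ/N)`. -/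
def columnVertices (A : SL(2, ZMod N)) : PlatonicVertex N × PlatonicVertex N :=
  (Quotient.mk (primitivePairSetoid N) ⟨(A 0 0, A 1 0),
      gcd_val_eq_one (z := A 1 1) (w := -A 0 1) (by
      have h := A.det_coe
      rw [Matrix.det_fin_two] at h
      linear_combination h)⟩,
    Quotient.mk (primitivePairSetoid N) ⟨(A 0 1, A 1 1),
      gcd_val_eq_one (z := -A 1 0) (w := A 0 0) (by
      have h := A.det_coe
      rw [Matrix.det_fin_two] at h
      linear_combination h)⟩)

/-- The vertices fix each column up to its own sign. Two different signs would change the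
determinant from `1` to `-1`, so that `1 = -1` in `ZMod N` and signs do not matter at all. -/
theorem columnVertices_eq_iff (A B : SL(2, ZMod N)) :
    columnVertices A = columnVertices B ↔ A = B ∨ A = -B := by
  have hA := A.det_coe
  have hB := B.det_coe
  rw [Matrix.det_fin_two] at hA hB
  constructor
  · intro h
    have h0 := Quotient.exact (congrArg Prod.fst h)
    have h1 := Quotient.exact (congrArg Prod.snd h)
    change (A 0 0, A 1 0) = (B 0 0, B 1 0) ∨ (A 0 0, A 1 0) = (-B 0 0, -B 1 0) at h0
    change (A 0 1, A 1 1) = (B 0 1, B 1 1) ∨ (A 0 1, A 1 1) = (-B 0 1, -B 1 1) at h1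
    simp only [Prod.mk.injEq] at h0 h1
    have hsign : ∀ e : (1 : ZMod N) = -1, ∀ x : ZMod N, -x = x := by
      intro e x
      linear_combination -x * e
    rcases h0 with ⟨a, c⟩ | ⟨a, c⟩ <;> rcases h1 with ⟨b, d⟩ | ⟨b, d⟩
    · left
      ext i j; fin_cases i <;> fin_cases j <;> assumption
    · have e : (1 : ZMod N) = -1 := by
        rw [a, b, c, d] at hA; linear_combination -hA - hB
      rw [hsign e] at b d
      left
      ext i j; fin_cases i <;> fin_cases j <;> assumption
    · have e : (1 : ZMod N) = -1 := by
        rw [a, b, c, d] at hA; linear_combination -hA - hB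
      rw [hsign e] at a c
      left
      ext i j; fin_cases i <;> fin_cases j <;> assumption
    · right
      ext i j; fin_cases i <;> fin_cases j <;> assumption
  · rintro (rfl | rfl)
    · rfl
    · refine Prod.ext (Quotient.sound ?_) (Quotient.sound ?_)
      · right; simp
      · right; simp

/-- Negating the second column keeps its vertex and turns determinant `-1` into `1`. Columns that
agree up to sign have determinant `0`, which excludes loops. -/
theorem exists_columnVertices_eq_iff [Fact (1 < N)] (u v : PlatonicVertex N) :
    (∃ A, columnVertices A = (u, v)) ↔ (platonicGraph N).Adj u v := by
  constructor
  · rintro ⟨A, hA⟩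
    have hdet := A.det_coe
    rw [Matrix.det_fin_two] at hdet
    refine ⟨?_, _, _, congrArg Prod.fst hA, congrArg Prod.snd hA, Or.inl ?_⟩
    · rintro rfl
      have h := Quotient.exact ((congrArg Prod.fst hA).trans (congrArg Prod.snd hA).symm)
      change (A 0 0, A 1 0) = (A 0 1, A 1 1) ∨ (A 0 0, A 1 0) = (-A 0 1, -A 1 1) at h
      simp only [Prod.mk.injEq] at h
      apply zero_ne_one (α := ZMod N)
      rcases h with ⟨a, c⟩ | ⟨a, c⟩ <;> rw [a, c] at hdet <;> linear_combination hdet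
    · linear_combination hdet
  · rintro ⟨-, p, q, rfl, rfl, h | h⟩
    · exact ⟨⟨!![p.1.1, q.1.1; p.1.2, q.1.2], by
        rw [Matrix.det_fin_two_of]; linear_combination h⟩, rfl⟩
    · refine ⟨⟨!![p.1.1, -q.1.1; p.1.2, -q.1.2], by
        rw [Matrix.det_fin_two_of]; linear_combination -h⟩, Prod.ext rfl (Quotient.sound ?_)⟩
      right; rfl

theorem mk_eq_mk_iff (g h : SL(2, ℤ)) :
    (g : ModularQuotient N) = h ↔
      columnVertices (Matrix.SpecialLinearGroup.map (Int.castRingHom (ZMod N)) g) =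
        columnVertices (Matrix.SpecialLinearGroup.map (Int.castRingHom (ZMod N)) h) := by
  rw [columnVertices_eq_iff, eq_comm (a := (g : ModularQuotient N)), QuotientGroup.eq]
  change _ = _ ∨ _ = _ ↔ _
  rw [map_mul, map_inv, inv_mul_eq_iff_eq_mul, inv_mul_eq_iff_eq_mul, mul_one, mul_neg, mul_one]

/-- The directed edge of the Platonic graph that belongs to a side of the surface. -/
def sideDart [Fact (1 < N)] : ModularQuotient N → (platonicGraph N).Dart :=
  Quotient.lift
    (fun g => ⟨columnVertices (Matrix.SpecialLinearGroup.map (Int.castRingHom (ZMod N)) g),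
      (exists_columnVertices_eq_iff _ _).mp ⟨_, rfl⟩⟩)
    (fun g h hgh => SimpleGraph.Dart.ext _ _ (by
      exact (mk_eq_mk_iff g h).mp (Quotient.sound hgh)))

/-- Injectivity is the sign argument of `columnVertices_eq_iff`; surjectivity is the lifting of
matrices from `ZMod N` to `ℤ`. -/
theorem sideDart_bijective [Fact (1 < N)] : Function.Bijective (sideDart (N := N)) := by
  constructor
  · intro q r
    obtain ⟨g, rfl⟩ := QuotientGroup.mk_surjective q
    obtain ⟨h, rfl⟩ := QuotientGroup.mk_surjective r
    intro hgh
    exact (mk_eq_mk_iff g h).mpr (congrArg SimpleGraph.Dart.toProd hgh)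
  · rintro ⟨⟨u, v⟩, huv⟩
    obtain ⟨A, hA⟩ := (exists_columnVertices_eq_iff u v).mpr huv
    obtain ⟨g, rfl⟩ := specialLinearGroup_map_surjective N A
    exact ⟨(g : ModularQuotient N), SimpleGraph.Dart.ext _ _ hA⟩

theorem card_dart {V : Type*} [Finite V] (G : SimpleGraph V) :
    Nat.card G.Dart = 2 * Nat.card G.edgeSet := by
  classical
  have := Fintype.ofFinite V
  rw [Nat.card_eq_fintype_card, G.dart_card_eq_twice_card_edges, Nat.card_eq_fintype_card,
    SimpleGraph.edgeFinset_card]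

theorem card_platonicGraph_edgeSet [N.AtLeastTwo] :
    Nat.card (platonicGraph N).edgeSet = Nat.card (platonicSurface N).Edge := by
  have : Fact (1 < N) := ⟨Nat.AtLeastTwo.one_lt⟩
  have h1 := card_dart (platonicGraph N)
  rw [← Nat.card_eq_of_bijective _ sideDart_bijective] at h1
  have h2 : 2 * _ = Nat.card (ModularQuotient N) := (platonicSurface N).two_mul_card_edge
  omega

end Platonic

/-- Every vertex of the triangulation of `S(Π_N)` has degree at least `N`. -/
theorem le_of_platonicSurface_pow_eq {N : ℕ} [N.AtLeastTwo] (s : ModularQuotient N) {j : ℕ}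
    (hj : 0 < j)
    (h : (((platonicSurface N).next * (platonicSurface N).glue) ^ j) s = s) : N ≤ j := by
  -- Since `S * S = -1`, gluing followed by `next` is multiplication by `-T`, which is `T` in the
  -- quotient.
  have hT : ((ModularGroup.S : SL(2, ℤ)) : ModularQuotient N) *
      ((ModularGroup.S * ModularGroup.T : SL(2, ℤ)) : ModularQuotient N) =
      ((ModularGroup.T : SL(2, ℤ)) : ModularQuotient N) := by
    rw [← QuotientGroup.mk_mul, ← mul_assoc, eq_comm, QuotientGroup.eq]
    have h2 : ModularGroup.T⁻¹ * (ModularGroup.S * ModularGroup.S * ModularGroup.T) =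
      (-1 : SL(2, ℤ)) := by decide
    rw [h2]
    right
    ext i j
    fin_cases i <;> fin_cases j <;> simp
  have hpow : ∀ n : ℕ, (((platonicSurface N).next * (platonicSurface N).glue) ^ n) s =
      s * ((ModularGroup.T : SL(2, ℤ)) : ModularQuotient N) ^ n := by
    intro n
    induction n with
    | zero => exact (mul_one s).symm
    | succ n ih =>
      rw [pow_succ']
      refine (congrArg ((platonicSurface N).next * (platonicSurface N).glue) ih).trans ?_
      change s * _ ^ n * ((ModularGroup.S : SL(2, ℤ)) : ModularQuotient N) *
        ((ModularGroup.S * ModularGroup.T : SL(2, ℤ)) : ModularQuotient N) = _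
      rw [mul_assoc, hT, pow_succ, mul_assoc]
  replace h : s * ((ModularGroup.T : SL(2, ℤ)) : ModularQuotient N) ^ j = s := (hpow j).symm.trans h
  rw [mul_eq_left, ← QuotientGroup.mk_pow, QuotientGroup.eq_one_iff] at h
  -- The upper right entry of `T ^ j` is `j`, while that of `1` and of `-1` is `0`.
  have h01 : ((j : ℕ) : ZMod N) = 0 := by
    have hTj : (ModularGroup.T ^ j) 0 1 = (j : ℤ) := by
      rw [← zpow_natCast, ModularGroup.coe_T_zpow]
      rfl
    rw [← Int.cast_natCast, ← hTj]
    rcases h with h | h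
    · exact congrArg (fun m : SL(2, ZMod N) => m 0 1) h
    · refine (congrArg (fun m : SL(2, ZMod N) => m 0 1) h).trans ?_
      simp
  exact Nat.le_of_dvd hj ((ZMod.natCast_eq_zero_iff _ _).mp h01)

theorem tendsto_platonic :
    Tendsto (fun n : ℕ => 6 * ((platonicSurface (n + 2)).genus : ℝ) /
      (Nat.card (platonicGraph (n + 2)).edgeSet : ℝ)) atTop (𝓝 1) := by
  simp only [card_platonicGraph_edgeSet]
  exact tendsto_six_mul_genus_div (fun n => platonicSurface (n + 2)) (fun n => n + 2)
    (tendsto_add_atTop_nat 2) (fun n => by omega)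
    (fun n s j hj h => le_of_platonicSurface_pow_eq s hj h)

/-! ### The orders of the generators of `G_k` -/

theorem upperTriangular_add_self (A : UpperTriangular) : A + A = 0 := by
  ext1 i j _
  rw [IncidenceAlgebra.add_apply]
  ext a b
  exact CharTwo.add_self_eq_zero (A i j a b)

/-- Iterated squaring: `1` and `A` commute, and the doubled cross term vanishes in characteristic
two. -/
theorem one_add_pow_two_pow (A : UpperTriangular) (a : ℕ) :
    (1 + A) ^ 2 ^ a = 1 + A ^ 2 ^ a := by
  induction a with
  | zero => rw [pow_zero, pow_one, pow_one]
  | succ a ih =>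
    rw [pow_succ, pow_mul, ih, pow_mul, sq, sq]
    have h : (1 + A ^ 2 ^ a) * (1 + A ^ 2 ^ a) =
        1 + A ^ 2 ^ a * A ^ 2 ^ a + (A ^ 2 ^ a + A ^ 2 ^ a) := by noncomm_ring
    rw [h, upperTriangular_add_self, add_zero]

/-- `blkA` is singular, but its lower right `2 × 2` block has order three; so its powers keep
returning to `blkA`, `blkA ^ 2`, `blkA ^ 3`. -/
theorem blkA_pow_ne_zero (n : ℕ) : blkA ^ n ≠ 0 := by
  have h4 : blkA ^ 4 = blkA := by decide +kernel
  have h : blkA ^ n = 1 ∨ blkA ^ n = blkA ∨ blkA ^ n = blkA ^ 2 ∨ blkA ^ n = blkA ^ 3 := by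
    induction n with
    | zero => exact Or.inl (pow_zero _)
    | succ n ih =>
      rw [pow_succ]
      rcases ih with h | h | h | h <;> rw [h]
      · right; left; rw [one_mul]
      · right; right; left; rw [sq]
      · right; right; right; rw [← pow_succ]
      · right; left; rw [← pow_succ, h4]
  rcases h with h | h | h | h <;> rw [h]
  · exact (by decide +kernel : (1 : Block) ≠ 0)
  · exact (by decide +kernel : blkA ≠ 0)
  · exact (by decide +kernel : blkA ^ 2 ≠ 0)
  · exact (by decide +kernel : blkA ^ 3 ≠ 0)

/-- `matX - 1` is strictly upper triangular with constant first diagonal `blkA`. A path of `m`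
increasing steps advances by at least `m`, and by exactly `m` only if every step is `1`. -/
theorem matX_sub_one_pow (m : ℕ) :
    (∀ i j, j < i + m → ((matX.val - 1) ^ m) i j = 0) ∧
      ∀ i, ((matX.val - 1) ^ m) i (i + m) = blkA ^ m := by
  have h0 : ∀ i, (matX.val - 1) i i = 0 := by
    intro i
    rw [IncidenceAlgebra.sub_apply, IncidenceAlgebra.one_apply, if_pos rfl, sub_eq_zero]
    change (if i ≤ i then patX (i - i) (i % 3) else 0) = 1
    rw [if_pos le_rfl, Nat.sub_self]
    rfl
  have h1 : ∀ i, (matX.val - 1) i (i + 1) = blkA := by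
    intro i
    rw [IncidenceAlgebra.sub_apply, IncidenceAlgebra.one_apply, if_neg (by omega), sub_zero]
    change (if i ≤ i + 1 then patX (i + 1 - i) (i % 3) else 0) = blkA
    rw [if_pos (by omega), Nat.add_sub_cancel_left]
    rfl
  induction m with
  | zero =>
    refine ⟨fun i j hij => IncidenceAlgebra.apply_eq_zero_of_not_le (by omega) _, fun i => ?_⟩
    rw [pow_zero, pow_zero, IncidenceAlgebra.one_apply, if_pos (add_zero i).symm]
  | succ m ih =>
    obtain ⟨ih1, ih2⟩ := ih
    constructor
    · intro i j hij
      rw [pow_succ, IncidenceAlgebra.mul_apply]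
      refine Finset.sum_eq_zero fun l hl => ?_
      rw [Finset.mem_Icc] at hl
      by_cases h : l < i + m
      · rw [ih1 i l h, zero_mul]
      · obtain rfl : l = j := by omega
        rw [h0, mul_zero]
    · intro i
      rw [pow_succ, IncidenceAlgebra.mul_apply, Finset.sum_eq_single_of_mem (i + m)
        (by rw [Finset.mem_Icc]; omega), ih2, ← add_assoc, h1, pow_succ]
      intro l hl hne
      rw [Finset.mem_Icc] at hl
      by_cases h : l < i + m
      · rw [ih1 i l h, zero_mul]
      · obtain rfl : l = i + (m + 1) := by omega
        rw [h0, mul_zero]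

/-- If the first `k` upper diagonals of a power `X ^ m` of the matrix `X` of `x_0` vanish, then
`k < m`: for `m = 2 ^ a * b` with odd `b`, the diagonal number `2 ^ a` of `X ^ m` is a power of the
first diagonal of `X`. -/
theorem lt_of_diagonalsVanish_matX_pow {k m : ℕ} (hm : 0 < m)
    (h : DiagonalsVanish k (matX.val ^ m - 1)) : k < m := by
  obtain ⟨a, b, hb, rfl⟩ := Nat.exists_eq_two_pow_mul_odd hm.ne'
  obtain ⟨c, rfl⟩ := hb
  by_contra hk
  push Not at hk
  -- If `k ≥ m`, the diagonal number `2 ^ a` is among those assumed to vanish.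
  have hn : 2 ^ a ≤ k := (Nat.le_mul_of_pos_right _ (by omega)).trans hk
  have hn0 : 0 < 2 ^ a := by positivity
  obtain ⟨hz, hA⟩ := matX_sub_one_pow (2 ^ a)
  have hW : matX.val ^ 2 ^ a = 1 + (matX.val - 1) ^ 2 ^ a := by
    rw [← one_add_pow_two_pow, add_sub_cancel]
  have hW2 : (matX.val ^ 2 ^ a) ^ 2 - 1 = (matX.val - 1) ^ 2 ^ (a + 1) := by
    rw [← pow_mul, ← pow_succ, sub_eq_iff_eq_add', ← one_add_pow_two_pow, add_sub_cancel]
  have hv : DiagonalsVanish (2 ^ a) ((matX.val ^ 2 ^ a) ^ 2 - 1) := by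
    rw [hW2]
    intro i j hij
    refine (matX_sub_one_pow _).1 i j ?_
    rw [pow_succ]
    omega
  -- With `W = X ^ 2 ^ a`, this is `W ^ (2 * c + 1) - 1 = (W ^ (2 * c) - 1) * W + (W - 1)`, where
  -- the geometric sum extracts the factor `W ^ 2 - 1`. That factor begins at the diagonal `2 ^ (a +
  -- 1)`, so the diagonal `2 ^ a` comes from `W - 1` alone.
  have hdec : matX.val ^ (2 ^ a * (2 * c + 1)) - 1 =
      ((matX.val ^ 2 ^ a) ^ 2 - 1) * (∑ i ∈ Finset.range c, ((matX.val ^ 2 ^ a) ^ 2) ^ i) *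
        matX.val ^ 2 ^ a + (matX.val - 1) ^ 2 ^ a := by
    rw [mul_geom_sum, sub_mul, one_mul, pow_mul, pow_succ, pow_mul, sub_add_eq_add_sub,
      add_sub_assoc]
    nth_rewrite 5 [hW]
    abel
  have h0 := h 0 (2 ^ a) (by omega)
  rw [hdec, IncidenceAlgebra.add_apply, (hv.mul_right _).mul_right _ 0 (2 ^ a) (by omega),
    zero_add] at h0
  have h1 := hA 0
  rw [zero_add, h0] at h1
  exact blkA_pow_ne_zero _ h1.symm

/-- All generators are conjugate to `matX` by powers of `matU`, and multiplication on either side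
preserves the vanishing of the first diagonals. -/
theorem lt_of_diagonalsVanish_matGen_pow {k m i : ℕ} (hm : 0 < m)
    (h : DiagonalsVanish k ((matGen i ^ m).val - 1)) : k < m := by
  refine lt_of_diagonalsVanish_matX_pow hm ?_
  have e : matX.val ^ m - 1 = (matU ^ i).val * ((matGen i ^ m).val - 1) * ((matU ^ i)⁻¹).val := by
    rw [mul_sub, sub_mul, mul_one, Units.mul_inv, ← Units.val_mul, ← Units.val_mul,
      ← Units.val_pow_eq_pow_val]
    congr 2
    have hc := conj_pow (a := (matU ^ i)⁻¹) (b := matX) (i := m)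
    rw [inv_inv] at hc
    rw [matGen, hc]
    group
  rw [e]
  exact (h.mul_left _).mul_right _

theorem toeplitzRep_genG (i : Fin 3) :
    toeplitzRep (genG i) = toeplitzGen ((![0, 1, 3] : Fin 3 → ℕ) i) := by
  fin_cases i
  · exact PresentedGroup.toGroup.of _
  · exact PresentedGroup.toGroup.of _
  · exact PresentedGroup.toGroup.of _

theorem mk_eq_one_iff (k : ℕ) (g : groupG) :
    (g : GroupGk k) = 1 ↔ DiagonalsVanish k ((toeplitzRep g).1.val - 1) := by
  rw [QuotientGroup.eq_one_iff, diagonalsVanish_sub_one]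
  rfl

/-- The order of a generator of `G_k` is greater than `k`. -/
theorem lt_of_genGk_pow_eq_one {k m : ℕ} {i : Fin 3} (hm : 0 < m) (h : genGk k i ^ m = 1) :
    k < m := by
  rw [genGk, ← QuotientGroup.mk_pow, mk_eq_one_iff, Subgroup.coe_pow, map_pow,
    toeplitzRep_genG] at h
  exact lt_of_diagonalsVanish_matGen_pow hm h

/-! ### Vertex degrees of the covering surface. -/

section Covering

variable {Q : Type} [Group Q] (x : Fin 3 → Q)

/-- The translation given by two steps around a vertex of the covering surface. -/
def vertexTranslation : Bool → Fin 3 → Q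
  | true, i => crossing x i * (crossing x (i - 1))⁻¹
  | false, i => (crossing x i)⁻¹ * crossing x (i + 1)

theorem vertex_step_two (h : Q) (c : Bool) (i : Fin 3) :
    ((coverNext Q * coverGlue x) ^ 2) (h, c, i) = (h * vertexTranslation x c i, c, i) := by
  rw [sq]
  cases c <;> simp [coverNext, coverGlue, vertexTranslation, mul_assoc]

theorem vertex_step_two_mul (h : Q) (c : Bool) (i : Fin 3) (n : ℕ) :
    ((coverNext Q * coverGlue x) ^ (2 * n)) (h, c, i) =
      (h * vertexTranslation x c i ^ n, c, i) := by
  induction n generalizing h with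
  | zero => simp
  | succ n ih =>
    rw [mul_add, mul_one, pow_add, Equiv.Perm.mul_apply, vertex_step_two, ih, pow_succ', mul_assoc]

/-- Every step around a vertex changes the colour of the triangle. -/
theorem vertex_step_odd_ne (s : Q × Bool × Fin 3) (n : ℕ) :
    ((coverNext Q * coverGlue x) ^ (2 * n + 1)) s ≠ s := by
  obtain ⟨h, c, i⟩ := s
  intro e
  rw [pow_succ', Equiv.Perm.mul_apply, vertex_step_two_mul] at e
  have := congrArg (fun s : Q × Bool × Fin 3 => s.2.1) e
  cases c <;> simp [coverNext, coverGlue] at this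

variable {x}

/-- In all six cases the translation is conjugate to the inverse of a generator; the relator is
needed for the two cases at the vertex `v_1`, where `x 2 * x 0` and `x 0 * x 2` occur. -/
theorem exists_pow_eq_one_of_vertexTranslation (hprod : x 0 * x 1 * x 2 = 1) (c : Bool) (i : Fin 3)
    {n : ℕ} (h : vertexTranslation x c i ^ n = 1) : ∃ j, x j ^ n = 1 := by
  have h1 : x 2 * x 0 = (x 1)⁻¹ := by
    rw [eq_inv_iff_mul_eq_one, ← mul_left_cancel_iff (a := (x 2)⁻¹)]
    rw [mul_one, mul_assoc, inv_mul_cancel_left]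
    exact eq_inv_of_mul_eq_one_left hprod
  have h2 : x 0 * x 2 = x 0 * (x 1)⁻¹ * (x 0)⁻¹ := by
    rw [← h1]; group
  have e1 : (2 : Fin 3) + 1 = 0 := rfl
  have e2 : (0 : Fin 3) - 1 = 2 := rfl
  cases c <;> fin_cases i
  · exact ⟨2, by simpa [vertexTranslation, crossing] using h⟩
  · exact ⟨0, by simpa [vertexTranslation, crossing] using h⟩
  · exact ⟨1, by simpa [vertexTranslation, crossing, h2, e1] using h⟩
  · exact ⟨1, by simpa [vertexTranslation, crossing, h1, e2] using h⟩
  · exact ⟨2, by simpa [vertexTranslation, crossing] using h⟩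
  · exact ⟨0, by simpa [vertexTranslation, crossing] using h⟩

theorem le_of_cover_pow_eq (hprod : x 0 * x 1 * x 2 = 1) {L : ℕ}
    (hL : ∀ i m, 0 < m → x i ^ m = 1 → L ≤ m) (s : Q × Bool × Fin 3) (j : ℕ) (hj : 0 < j)
    (h : ((coverNext Q * coverGlue x) ^ j) s = s) : L ≤ j := by
  obtain ⟨n, rfl | rfl⟩ := Nat.even_or_odd' j
  · obtain ⟨g, c, i⟩ := s
    rw [vertex_step_two_mul, Prod.mk.injEq, mul_eq_left] at h
    obtain ⟨l, hl⟩ := exists_pow_eq_one_of_vertexTranslation hprod c i h.1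
    have := hL l n (by omega) hl
    omega
  · exact absurd h (vertex_step_odd_ne x s n)

end Covering

theorem tendsto_surfaceT :
    Tendsto (fun k : ℕ => 6 * ((surfaceT k).genus : ℝ) /
      (Nat.card (surfaceT k).Edge : ℝ)) atTop (𝓝 1) :=
  tendsto_six_mul_genus_div surfaceT (fun k => k + 1) (tendsto_add_atTop_nat 1)
    (fun k => by omega)
    (fun k s j hj h => le_of_cover_pow_eq (genGk_prod k)
      (fun _ _ hm hx => lt_of_genGk_pow_eq_one hm hx) s j hj h)

/-! ### Relations of length three between the generators of `G_k` -/

/-- The elements `x i` and `(x i)⁻¹`. -/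
def signedGen {Q : Type*} [Group Q] (x : Fin 3 → Q) (a : Fin 3 × Bool) : Q :=
  if a.2 then x a.1 else (x a.1)⁻¹

/-- The triples of signed generators whose product is a cyclic permutation of the relator
`x 0 * x 1 * x 2` or of its inverse. -/
def IsCyclicTriple (a b c : Fin 3 × Bool) : Prop :=
  b.2 = a.2 ∧ c.2 = a.2 ∧
    if a.2 then b.1 = a.1 + 1 ∧ c.1 = b.1 + 1 else a.1 = b.1 + 1 ∧ b.1 = c.1 + 1

instance (a b c : Fin 3 × Bool) : Decidable (IsCyclicTriple a b c) := by
  unfold IsCyclicTriple; infer_instance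

/-- Two upper diagonals with period three. -/
abbrev DiagonalPair : Type := (Fin 3 → Block) × (Fin 3 → Block)

namespace DiagonalPair

/-- The first two upper diagonals of a product of unitriangular matrices. -/
def mul (p q : DiagonalPair) : DiagonalPair :=
  (fun r => p.1 r + q.1 r, fun r => p.2 r + p.1 r * q.1 (r + 1) + q.2 r)

/-- The first two upper diagonals of the inverse of a unitriangular matrix. -/
def inv (p : DiagonalPair) : DiagonalPair :=
  (fun r => -p.1 r, fun r => p.1 r * p.1 (r + 1) - p.2 r)

/-- The first two upper diagonals of a matrix in `H`. -/
def ofToeplitz (A : toeplitzGroup) : DiagonalPair :=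
  (fun r => A.1.val r (r + 1), fun r => A.1.val r (r + 2))

theorem ofToeplitz_mul (A B : toeplitzGroup) :
    ofToeplitz (A * B) = mul (ofToeplitz A) (ofToeplitz B) := by
  -- The index `r + 1` wraps around in `Fin 3`: for `r = 2` the row `3` is replaced by the row `0`,
  -- by periodicity.
  have hB : ∀ r : Fin 3, B.1.val (r + 1) (r + 2) =
      B.1.val ((r + 1 : Fin 3) : ℕ) (((r + 1 : Fin 3) : ℕ) + 1) := by
    intro r
    fin_cases r
    · rfl
    · rfl
    · exact B.2.2 0 1
  refine Prod.ext (funext fun r => ?_) (funext fun r => ?_)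
  · change (A.1.val * B.1.val) r (r + 1) = A.1.val r (r + 1) + B.1.val r (r + 1)
    rw [IncidenceAlgebra.mul_apply, ← Finset.insert_Icc_add_one_left_eq_Icc (by omega),
      Finset.Icc_self, Finset.sum_pair (by omega), A.2.1, B.2.1, one_mul, mul_one, add_comm]
  · change (A.1.val * B.1.val) r (r + 2) = A.1.val r (r + 2) + A.1.val r (r + 1) *
      B.1.val ((r + 1 : Fin 3) : ℕ) (((r + 1 : Fin 3) : ℕ) + 1) + B.1.val r (r + 2)
    have hI : Finset.Icc (r : ℕ) (r + 2) = {(r : ℕ), (r : ℕ) + 1, (r : ℕ) + 2} := by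
      ext l
      simp only [Finset.mem_Icc, Finset.mem_insert, Finset.mem_singleton]
      omega
    rw [IncidenceAlgebra.mul_apply, hI, Finset.sum_insert (by simp), Finset.sum_pair (by omega),
      A.2.1, B.2.1, one_mul, mul_one, hB]
    abel

theorem ofToeplitz_eq_zero {k : ℕ} (hk : 2 ≤ k) {A : toeplitzGroup}
    (h : DiagonalsVanish k (A.1.val - 1)) : ofToeplitz A = (0, 0) := by
  rw [diagonalsVanish_sub_one] at h
  exact Prod.ext (funext fun r => h _ _ (by omega) (by omega))
    (funext fun r => h _ _ (by omega) (by omega))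

theorem ofToeplitz_inv (A : toeplitzGroup) : ofToeplitz A⁻¹ = inv (ofToeplitz A) := by
  have h : mul (ofToeplitz A) (ofToeplitz A⁻¹) = (0, 0) := by
    rw [← ofToeplitz_mul, mul_inv_cancel]
    refine ofToeplitz_eq_zero le_rfl ?_
    intro i j _
    change ((1 : UpperTriangular) - 1) i j = 0
    rw [sub_self]
    rfl
  have h1 : ∀ r, (ofToeplitz A⁻¹).1 r = -(ofToeplitz A).1 r := fun r =>
    eq_neg_of_add_eq_zero_right (congrFun (congrArg Prod.fst h) r)
  refine Prod.ext (funext h1) (funext fun r => ?_)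
  have h2 : (ofToeplitz A).2 r + (ofToeplitz A).1 r * (ofToeplitz A⁻¹).1 (r + 1) +
    (ofToeplitz A⁻¹).2 r = 0 := congrFun (congrArg Prod.snd h) r
  rw [h1, mul_neg] at h2
  change _ = (ofToeplitz A).1 r * (ofToeplitz A).1 (r + 1) - (ofToeplitz A).2 r
  rw [eq_neg_of_add_eq_zero_right h2]
  abel

/-- The first two upper diagonals of the matrices of `x_0`, `x_1` and `x_3`. -/
def gen : Fin 3 → DiagonalPair :=
  ![(![!![0, 0, 0; 0, 0, 1; 0, 1, 1], !![0, 0, 0; 0, 0, 1; 0, 1, 1],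
      !![0, 0, 0; 0, 0, 1; 0, 1, 1]],
    ![!![0, 0, 0; 0, 1, 0; 0, 0, 1], !![0, 0, 0; 0, 1, 0; 0, 0, 1],
      !![0, 0, 0; 0, 1, 0; 0, 0, 1]]),
   (![!![0, 0, 0; 0, 1, 0; 1, 1, 1], !![0, 1, 1; 1, 0, 0; 0, 0, 0],
      !![0, 1, 0; 0, 0, 1; 0, 1, 0]],
    ![!![0, 0, 0; 1, 1, 1; 0, 1, 1], !![0, 1, 0; 0, 0, 1; 0, 0, 0],
      !![1, 1, 1; 1, 0, 1; 1, 1, 1]]),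
   (![!![0, 0, 0; 0, 1, 1; 1, 0, 0], !![0, 1, 1; 1, 0, 1; 0, 1, 1],
      !![0, 1, 0; 0, 0, 0; 0, 0, 1]],
    ![!![0, 0, 0; 0, 1, 1; 1, 0, 1], !![0, 1, 1; 0, 1, 0; 0, 1, 1],
      !![1, 0, 0; 0, 0, 0; 1, 1, 1]])]

theorem ofToeplitz_gen (i : Fin 3) :
    ofToeplitz (toeplitzGen ((![0, 1, 3] : Fin 3 → ℕ) i)) = gen i := by
  have h : ∀ i r : Fin 3,
      (matGen ((![0, 1, 3] : Fin 3 → ℕ) i)).val (r : ℕ) ((r : ℕ) + 1) = (gen i).1 r ∧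
      (matGen ((![0, 1, 3] : Fin 3 → ℕ) i)).val (r : ℕ) ((r : ℕ) + 2) = (gen i).2 r := by
    simp only [matGen_val]
    decide +kernel
  exact Prod.ext (funext fun r => (h i r).1) (funext fun r => (h i r).2)

/-- The first two upper diagonals of the matrices of the generators and their inverses. -/
def signed (a : Fin 3 × Bool) : DiagonalPair := if a.2 then gen a.1 else inv (gen a.1)

theorem ofToeplitz_signedGen (a : Fin 3 × Bool) :
    ofToeplitz (toeplitzRep (signedGen genG a : groupG)) = signed a := by
  obtain ⟨i, _ | _⟩ := a
  · change ofToeplitz (toeplitzRep ((genG i)⁻¹ : groupG)) = inv (gen i)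
    rw [Subgroup.coe_inv, map_inv, ofToeplitz_inv, toeplitzRep_genG, ofToeplitz_gen]
  · change ofToeplitz (toeplitzRep (genG i)) = gen i
    rw [toeplitzRep_genG, ofToeplitz_gen]

/-- The second diagonal is indispensable: on the first one, with entries in characteristic two, each
generator coincides with its inverse. -/
theorem signed_injective : ∀ a b : Fin 3 × Bool, mul (signed a) (inv (signed b)) = (0, 0) →
    a = b := by
  decide +kernel

/-- This excludes accidental triangles in the Cayley graph. The first diagonals merely add up, so
only the second one detects the order of the factors. -/
theorem signed_triple : ∀ a b c : Fin 3 × Bool,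
    mul (mul (signed a) (signed b)) (signed c) = (0, 0) → IsCyclicTriple a b c := by
  decide +kernel

end DiagonalPair

theorem coe_signedGen (k : ℕ) (a : Fin 3 × Bool) :
    ((signedGen genG a : groupG) : GroupGk k) = signedGen (genGk k) a := by
  obtain ⟨i, _ | _⟩ := a <;> rfl

open DiagonalPair in
theorem signedGen_genGk_injective {k : ℕ} (hk : 2 ≤ k) :
    Function.Injective (signedGen (genGk k)) := by
  intro a b h
  rw [← mul_inv_eq_one, ← coe_signedGen, ← coe_signedGen, ← QuotientGroup.mk_inv,
    ← QuotientGroup.mk_mul, mk_eq_one_iff] at h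
  have := ofToeplitz_eq_zero hk h
  rw [Subgroup.coe_mul, Subgroup.coe_inv, map_mul, map_inv, ofToeplitz_mul, ofToeplitz_inv,
    ofToeplitz_signedGen, ofToeplitz_signedGen] at this
  exact signed_injective a b this

open DiagonalPair in
theorem isCyclicTriple_of_mul_eq_one {k : ℕ} (hk : 2 ≤ k) {a b c : Fin 3 × Bool}
    (h : signedGen (genGk k) a * signedGen (genGk k) b * signedGen (genGk k) c = 1) :
    IsCyclicTriple a b c := by
  rw [← coe_signedGen, ← coe_signedGen, ← coe_signedGen, ← QuotientGroup.mk_mul,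
    ← QuotientGroup.mk_mul, mk_eq_one_iff] at h
  have := ofToeplitz_eq_zero hk h
  rw [Subgroup.coe_mul, Subgroup.coe_mul, map_mul, map_mul, ofToeplitz_mul, ofToeplitz_mul,
    ofToeplitz_signedGen, ofToeplitz_signedGen, ofToeplitz_signedGen] at this
  exact signed_triple a b c this

/-! ### The dual graph of the covering surface -/

section Dual

variable {Q : Type} [Group Q] {x : Fin 3 → Q}

/-- A generator equal to `1` would equal its own inverse, so the three crossings `x 2`, `1`, `(x
0)⁻¹` are distinct. -/
theorem crossing_injective (hinj : Function.Injective (signedGen x)) :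
    Function.Injective (crossing x) := by
  have hne : ∀ a : Fin 3 × Bool, signedGen x a ≠ 1 := by
    rintro ⟨i, c⟩ h
    have h' : signedGen x (i, c) = signedGen x (i, !c) := by
      cases c <;> simp_all [signedGen]
    have := hinj h'
    cases c <;> simp at this
  have h0 : x 2 ≠ 1 := hne (2, true)
  have h1 : (x 0)⁻¹ ≠ 1 := hne (0, false)
  have h2 : x 2 ≠ (x 0)⁻¹ := fun h => by simpa using hinj (a₁ := (2, true)) (a₂ := (0, false)) h
  intro i j h
  fin_cases i <;> fin_cases j <;> first
    | rfl | exact absurd h h0 | exact absurd h h1 | exact absurd h h2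
    | exact absurd h.symm h0 | exact absurd h.symm h1 | exact absurd h.symm h2

section Surface

variable (hfin : Finite Q) (hprod : x 0 * x 1 * x 2 = 1)
  (hgen : Subgroup.closure (Set.range x) = ⊤)

/-- The triangle of the covering surface with the group element `h` and the colour `c`. -/
def coverFace (p : Q × Bool) : (coveringSurface Q x hfin hprod hgen).Face :=
  Quotient.mk _ ((p.1, p.2, 0) : Q × Bool × Fin 3)

theorem mk_eq_coverFace (h : Q) (c : Bool) (i : Fin 3) :
    (Quotient.mk _ ((h, c, i) : Q × Bool × Fin 3) : (coveringSurface Q x hfin hprod hgen).Face) =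
      coverFace hfin hprod hgen (h, c) := by
  refine Quotient.sound ?_
  change (coverNext Q).SameCycle (h, c, i) (h, c, 0)
  have key : ∀ i : Fin 3, (coverNext Q).SameCycle (h, c, i + 1) (h, c, 0) →
      (coverNext Q).SameCycle (h, c, i) (h, c, 0) := by
    intro i hi
    cases c
    -- On white triangles `next` lowers the index, so the cycle is followed backwards.
    · have : coverNext Q (h, false, i + 1) = (h, false, i) := by simp [coverNext]
      rwa [← Equiv.Perm.sameCycle_apply_left, this] at hi
    · rw [← Equiv.Perm.sameCycle_apply_left]
      exact hi
  have h0 : (coverNext Q).SameCycle (h, c, 0) (h, c, 0) := Equiv.Perm.SameCycle.refl _ _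
  fin_cases i
  · exact h0
  · exact key 1 (key 2 h0)
  · exact key 2 h0

/-- The permutation `next` changes neither the group element nor the colour, and reaches all three
side numbers. -/
theorem coverFace_bijective : Function.Bijective (coverFace hfin hprod hgen) := by
  constructor
  · rintro ⟨h, c⟩ ⟨h', c'⟩ e
    have hs : (coverNext Q).SameCycle (h, c, 0) (h', c', 0) := Quotient.exact e
    obtain ⟨n, hn⟩ := hs.exists_nat_pow_eq
    have inv : ∀ (n : ℕ) (s : Q × Bool × Fin 3),
        ((coverNext Q ^ n) s).1 = s.1 ∧ ((coverNext Q ^ n) s).2.1 = s.2.1 := by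
      intro n s
      induction n with
      | zero => exact ⟨rfl, rfl⟩
      | succ n ih =>
        rw [pow_succ', Equiv.Perm.mul_apply]
        exact ih
    have := inv n (h, c, 0)
    rw [hn] at this
    exact Prod.ext this.1.symm this.2.symm
  · intro f
    obtain ⟨⟨h, c, i⟩, rfl⟩ := Quotient.exists_rep f
    exact ⟨(h, c), (mk_eq_coverFace hfin hprod hgen h c i).symm⟩

theorem dualGraph_adj_iff (p q : Q × Bool) :
    (coveringSurface Q x hfin hprod hgen).dualGraph.Adj (coverFace hfin hprod hgen p)
      (coverFace hfin hprod hgen q) ↔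
    q.2 = !p.2 ∧ ∃ i, q.1 = if p.2 then p.1 * crossing x i else p.1 * (crossing x i)⁻¹ := by
  have inj := (coverFace_bijective hfin hprod hgen).1
  obtain ⟨h, c⟩ := p
  constructor
  · rintro ⟨-, ⟨h', c', i⟩, hs, hs'⟩
    have e1 := inj ((mk_eq_coverFace hfin hprod hgen h' c' i).symm.trans hs)
    have e2 := inj ((mk_eq_coverFace hfin hprod hgen _ _ _).symm.trans hs')
    rw [Prod.mk.injEq] at e1
    obtain ⟨rfl, rfl⟩ := e1
    subst e2
    exact ⟨rfl, i, rfl⟩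
  · obtain ⟨h', c'⟩ := q
    rintro ⟨hc, i, hi⟩
    simp only at hc hi
    subst hc hi
    refine ⟨fun e => ?_, ((h, c, i) : Q × Bool × Fin 3), mk_eq_coverFace hfin hprod hgen _ _ _,
      mk_eq_coverFace hfin hprod hgen _ _ _⟩
    have := congrArg Prod.snd (inj e)
    cases c <;> simp at this

theorem coverFace_ne_coverFace_glue (s : (coveringSurface Q x hfin hprod hgen).Side) :
    (Quotient.mk _ s : (coveringSurface Q x hfin hprod hgen).Face) ≠
      Quotient.mk _ ((coveringSurface Q x hfin hprod hgen).glue s) := by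
  obtain ⟨h, c, i⟩ := s
  intro e
  have := congrArg Prod.snd ((coverFace_bijective hfin hprod hgen).1
    (((mk_eq_coverFace hfin hprod hgen h c i).symm.trans e).trans
      (mk_eq_coverFace hfin hprod hgen _ _ _)))
  cases c <;> simp at this

/-- If the crossings are distinct, then different edges of the covering surface belong to different
edges of the dual graph. -/
theorem card_dualGraph_edgeSet (hc : Function.Injective (crossing x)) :
    Nat.card (coveringSurface Q x hfin hprod hgen).dualGraph.edgeSet =
      Nat.card (coveringSurface Q x hfin hprod hgen).Edge := by
  let S := coveringSurface Q x hfin hprod hgen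
  have : Finite S.Face := Finite.of_surjective _ (coverFace_bijective hfin hprod hgen).2
  let f : S.Side → S.dualGraph.Dart := fun s =>
    ⟨(Quotient.mk _ s, Quotient.mk _ (S.glue s)),
      coverFace_ne_coverFace_glue hfin hprod hgen s, s, rfl, rfl⟩
  have hf : Function.Bijective f := by
    constructor
    · rintro ⟨h, c, i⟩ ⟨h', c', i'⟩ e
      have e1 : coverFace hfin hprod hgen _ = coverFace hfin hprod hgen _ :=
        (mk_eq_coverFace hfin hprod hgen h c i).symm.trans
        ((congrArg (fun d : S.dualGraph.Dart => d.fst) e).trans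
          (mk_eq_coverFace hfin hprod hgen h' c' i'))
      have e2 : coverFace hfin hprod hgen _ = coverFace hfin hprod hgen _ :=
        (mk_eq_coverFace hfin hprod hgen _ _ i).symm.trans
        ((congrArg (fun d : S.dualGraph.Dart => d.snd) e).trans
          (mk_eq_coverFace hfin hprod hgen _ _ i'))
      have e1' := (coverFace_bijective hfin hprod hgen).1 e1
      have e2' := congrArg Prod.fst ((coverFace_bijective hfin hprod hgen).1 e2)
      rw [Prod.mk.injEq] at e1'
      obtain ⟨rfl, rfl⟩ := e1'
      have hi : i = i' := by
        cases c
        · exact hc (by simpa using e2')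
        · exact hc (by simpa using e2')
      rw [hi]
    · rintro ⟨⟨u, v⟩, hne, s, hu, hv⟩
      exact ⟨s, SimpleGraph.Dart.ext _ _ (Prod.ext hu hv)⟩
  have h1 := card_dart S.dualGraph
  rw [← Nat.card_eq_of_bijective _ hf] at h1
  have h2 := S.two_mul_card_edge
  change Nat.card S.dualGraph.edgeSet = Nat.card S.Edge
  omega

end Surface

/-! ### Triangles of the Cayley graph -/

/-- The Cayley graph with respect to the elements `(x i)^{±1}`. -/
abbrev signedCayley (x : Fin 3 → Q) : SimpleGraph Q :=
  SimpleGraph.mulCayley (Set.range x ∪ (Set.range x)⁻¹)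

theorem signedCayley_adj_of_mul_eq {v w : Q} (hne : v ≠ w) (i : Fin 3) (h : v * x i = w) :
    (signedCayley x).Adj v w := by
  rw [SimpleGraph.mulCayley_adj']
  exact ⟨hne, x i, Or.inl ⟨i, rfl⟩, Or.inl h⟩

theorem exists_signedGen_of_adj {v w : Q} (h : (signedCayley x).Adj v w) :
    ∃ a, v * signedGen x a = w := by
  rw [SimpleGraph.mulCayley_adj'] at h
  obtain ⟨-, g, ⟨i, rfl⟩ | ⟨i, hi⟩, h | h⟩ := h
  · exact ⟨(i, true), h⟩
  · exact ⟨(i, false), by simp [signedGen, h]⟩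
  · exact ⟨(i, false), by simp [signedGen, hi, h]⟩
  · exact ⟨(i, true), by simp [signedGen, hi, h]⟩

open Classical in
/-- The vertices of the Cayley graph that belong to the black neighbours of a white triangle. -/
noncomputable def whiteTriangle (x : Fin 3 → Q) (w : Q) : Finset Q :=
  Finset.univ.image fun i => w * (crossing x i)⁻¹

theorem mem_whiteTriangle {w v : Q} :
    v ∈ whiteTriangle x w ↔ ∃ i, w * (crossing x i)⁻¹ = v := by
  classical
  simp [whiteTriangle]

/-- Consecutive corners of a white triangle are thus joined by Cayley edges labelled `x (i - 1)`;
closing the triangle, at `i = 2`, uses the relator. -/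
theorem crossing_inv_add_one (hprod : x 0 * x 1 * x 2 = 1) (i : Fin 3) :
    (crossing x (i + 1))⁻¹ = (crossing x i)⁻¹ * x (i - 1) := by
  have h : (x 2)⁻¹ = x 0 * x 1 := (eq_inv_of_mul_eq_one_left hprod).symm
  have e1 : (2 : Fin 3) + 1 = 0 := rfl
  have e2 : (0 : Fin 3) - 1 = 2 := rfl
  fin_cases i
  · simp [crossing, e2]
  · simp [crossing]
  · simp [crossing, e1, h]

theorem exists_whiteTriangle_eq [DecidableEq Q] (hprod : x 0 * x 1 * x 2 = 1) {a b c : Q}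
    {i : Fin 3} (hab : a * x i = b) (hbc : b * x (i + 1) = c) :
    ∃ w, whiteTriangle x w = {a, b, c} := by
  have h1 := crossing_inv_add_one hprod (i + 1)
  have h2 := crossing_inv_add_one hprod (i + 1 + 1)
  rw [add_sub_cancel_right] at h1 h2
  -- This choice makes `a` the corner number `i + 1`, from which the following edges carry the
  -- labels `x i` and `x (i + 1)`.
  refine ⟨a * crossing x (i + 1), ?_⟩
  have e0 : a * crossing x (i + 1) * (crossing x (i + 1))⁻¹ = a := mul_inv_cancel_right _ _
  have e1 : a * crossing x (i + 1) * (crossing x (i + 1 + 1))⁻¹ = b := by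
    rw [h1, ← mul_assoc, e0, hab]
  have e2 : a * crossing x (i + 1) * (crossing x (i + 1 + 1 + 1))⁻¹ = c := by
    rw [h2, ← mul_assoc, e1, hbc]
  have hall : ∀ i j : Fin 3, j = i + 1 ∨ j = i + 1 + 1 ∨ j = i + 1 + 1 + 1 := by decide
  ext v
  rw [mem_whiteTriangle, Finset.mem_insert, Finset.mem_insert, Finset.mem_singleton]
  constructor
  · rintro ⟨j, rfl⟩
    rcases hall i j with rfl | rfl | rfl
    · exact Or.inl e0
    · exact Or.inr (Or.inl e1)
    · exact Or.inr (Or.inr e2)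
  · rintro (rfl | rfl | rfl)
    · exact ⟨_, e0⟩
    · exact ⟨_, e1⟩
    · exact ⟨_, e2⟩

theorem isNClique_whiteTriangle (hprod : x 0 * x 1 * x 2 = 1)
    (hinj : Function.Injective (signedGen x)) (w : Q) :
    (signedCayley x).IsNClique 3 (whiteTriangle x w) := by
  have hc := crossing_injective hinj
  have hd : Function.Injective fun i => w * (crossing x i)⁻¹ := fun i j h =>
    hc (inv_injective (mul_left_cancel h))
  classical
  rw [SimpleGraph.isNClique_iff]
  constructor
  · intro u hu v hv hne
    rw [Finset.mem_coe, mem_whiteTriangle] at hu hv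
    obtain ⟨i, rfl⟩ := hu
    obtain ⟨j, rfl⟩ := hv
    have hij : ∀ i j : Fin 3, j = i ∨ j = i + 1 ∨ i = j + 1 := by decide
    rcases hij i j with rfl | rfl | rfl
    · exact absurd rfl hne
    · exact signedCayley_adj_of_mul_eq hne (i - 1) (by rw [crossing_inv_add_one hprod, mul_assoc])
    · exact (signedCayley_adj_of_mul_eq hne.symm (j - 1)
        (by rw [crossing_inv_add_one hprod, mul_assoc])).symm
  · rw [whiteTriangle, Finset.card_image_of_injective _ hd, Finset.card_fin]

/-- The edge from corner `1` to corner `2` has label `x 0`. In a second triangle on the same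
vertices the same two points are corners `i` and `j`, and since the signed generators are distinct,
the label `x 0` forces `i = 1`. Equal corners number `1` give equal triangles. -/
theorem whiteTriangle_injective (hprod : x 0 * x 1 * x 2 = 1)
    (hinj : Function.Injective (signedGen x)) : Function.Injective (whiteTriangle x) := by
  intro w w' h
  have hmem : ∀ i, ∃ j, w' * (crossing x j)⁻¹ = w * (crossing x i)⁻¹ := fun i =>
    mem_whiteTriangle.mp (h ▸ mem_whiteTriangle.mpr ⟨i, rfl⟩)
  obtain ⟨i, hi⟩ := hmem 1
  obtain ⟨j, hj⟩ := hmem 2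
  rw [show (2 : Fin 3) = 1 + 1 from rfl, crossing_inv_add_one hprod, ← mul_assoc, ← hi, mul_assoc,
    mul_left_cancel_iff, show (1 : Fin 3) - 1 = 0 from rfl] at hj
  have hij : ∀ i j : Fin 3, j = i ∨ j = i + 1 ∨ i = j + 1 := by decide
  have key : ∀ a : Fin 3 × Bool, signedGen x (0, true) = signedGen x a → a = (0, true) :=
    fun a ha => (hinj ha).symm
  rcases hij i j with rfl | rfl | rfl
  · have h1 : x 0 = 1 := by simpa using hj.symm
    have := key (0, false) (by simp [signedGen, h1])
    simp at this
  · rw [crossing_inv_add_one hprod, mul_left_cancel_iff] at hj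
    have := key (i - 1, true) hj.symm
    have hi1 : i = 1 := by
      have := congrArg Prod.fst this
      simp only at this
      rw [sub_eq_zero] at this
      exact this
    rw [hi1] at hi
    exact (mul_right_cancel hi).symm
  · rw [crossing_inv_add_one hprod, mul_assoc, left_eq_mul, mul_eq_one_iff_inv_eq] at hj
    have := key (j - 1, false) hj.symm
    simp at this

/-- Every Cayley edge lies in a triangle, so the `Δ-Y`-transformation leaves no edge between two old
vertices. -/
theorem exists_mem_whiteTriangle_of_adj (hprod : x 0 * x 1 * x 2 = 1) {u v : Q}
    (h : (signedCayley x).Adj u v) :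
    ∃ w, u ∈ whiteTriangle x w ∧ v ∈ whiteTriangle x w := by
  have key : ∀ (u v : Q) (i : Fin 3), u * x i = v →
      ∃ w, u ∈ whiteTriangle x w ∧ v ∈ whiteTriangle x w := by
    classical
    intro u v i huv
    obtain ⟨w, hw⟩ := exists_whiteTriangle_eq hprod huv rfl
    exact ⟨w, by simp [hw], by simp [hw]⟩
  obtain ⟨⟨i, _ | _⟩, ha⟩ := exists_signedGen_of_adj h
  · obtain ⟨w, h1, h2⟩ := key v u i (by simp [← ha, signedGen])
    exact ⟨w, h2, h1⟩
  · exact key u v i ha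

/-- The labels read around a clique multiply to `1`, so by `htri` they form a cyclic permutation of
the relator or of its inverse. -/
theorem exists_whiteTriangle_eq_of_isNClique (hprod : x 0 * x 1 * x 2 = 1)
    (htri : ∀ a b c, signedGen x a * signedGen x b * signedGen x c = 1 → IsCyclicTriple a b c)
    {t : Finset Q}
    (ht : (signedCayley x).IsNClique 3 t) : ∃ w, whiteTriangle x w = t := by
  classical
  obtain ⟨a, b, c, hab, hac, hbc, rfl⟩ := SimpleGraph.is3Clique_iff.mp ht
  obtain ⟨p, hp⟩ := exists_signedGen_of_adj hab
  obtain ⟨q, hq⟩ := exists_signedGen_of_adj hbc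
  obtain ⟨r, hr⟩ := exists_signedGen_of_adj hac.symm
  have h1 : signedGen x p * signedGen x q * signedGen x r = 1 := by
    rw [← mul_left_cancel_iff (a := a), ← mul_assoc, ← mul_assoc, hp, hq, hr, mul_one]
  obtain ⟨hq2, hr2, hcyc⟩ := htri p q r h1
  obtain ⟨i, _ | _⟩ := p
  · obtain ⟨j, ε⟩ := q
    obtain ⟨l, δ⟩ := r
    simp only [Bool.false_eq_true, if_false] at hq2 hr2 hcyc
    obtain ⟨hij, hjl⟩ := hcyc
    subst hq2 hr2 hij
    -- For the inverse relator the clique is traversed in the opposite direction, `b`, `a`, `c`,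
    -- which makes the labels positive.
    have h2 : b * x (j + 1) = a := by simp [← hp, signedGen]
    have h3 : a * x (j + 1 + 1) = c := by
      have : j + 1 + 1 = l := by
        rw [hjl]
        exact (by decide : ∀ l : Fin 3, l + 1 + 1 + 1 = l) l
      rw [this]
      simp [← hr, signedGen]
    obtain ⟨w, hw⟩ := exists_whiteTriangle_eq hprod h2 h3
    exact ⟨w, by rw [hw, Finset.insert_comm]⟩
  · obtain ⟨j, ε⟩ := q
    simp only [if_true] at hq2 hcyc
    obtain ⟨rfl, -⟩ := hcyc
    subst hq2
    exact exists_whiteTriangle_eq hprod hp hq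

/-- The triangles of the Cayley graph are the white triangles. -/
theorem whiteTriangle_bijective (hprod : x 0 * x 1 * x 2 = 1)
    (hinj : Function.Injective (signedGen x))
    (htri : ∀ a b c, signedGen x a * signedGen x b * signedGen x c = 1 → IsCyclicTriple a b c) :
    Function.Bijective
    (fun w => (⟨whiteTriangle x w, isNClique_whiteTriangle hprod hinj w⟩ :
      {t : Finset Q // (signedCayley x).IsNClique 3 t})) := by
  constructor
  · intro w w' h
    exact whiteTriangle_injective hprod hinj (congrArg Subtype.val h)
  · rintro ⟨t, ht⟩
    obtain ⟨w, hw⟩ := exists_whiteTriangle_eq_of_isNClique hprod htri ht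
    exact ⟨w, Subtype.ext hw⟩

/-- Black triangles go with group elements and white ones with triangles of the Cayley graph. Both
graphs are then bipartite, and a black and a white triangle share a side exactly when the group
element is a corner of the Cayley triangle. -/
theorem nonempty_deltaY_iso_dualGraph (hprod : x 0 * x 1 * x 2 = 1)
    (hinj : Function.Injective (signedGen x))
    (htri : ∀ a b c, signedGen x a * signedGen x b * signedGen x c = 1 → IsCyclicTriple a b c)
    (hfin : Finite Q) (hgen : Subgroup.closure (Set.range x) = ⊤) :
    Nonempty (deltaY (signedCayley x) ≃g (coveringSurface Q x hfin hprod hgen).dualGraph) := by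
  let e : Q ⊕ Q ≃ Q ⊕ {t : Finset Q // (signedCayley x).IsNClique 3 t} :=
    Equiv.sumCongr (Equiv.refl Q) (Equiv.ofBijective _ (whiteTriangle_bijective hprod hinj htri))
  let color : Q ⊕ Q → Q × Bool := Sum.elim (fun h => (h, true)) (fun h => (h, false))
  have hcolor : Function.Bijective color := by
    constructor
    · rintro (h | h) (h' | h') hh <;> simp_all [color]
    · rintro ⟨h, _ | _⟩
      · exact ⟨Sum.inr h, rfl⟩
      · exact ⟨Sum.inl h, rfl⟩
  let f : Q ⊕ Q ≃ (coveringSurface Q x hfin hprod hgen).Face :=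
    Equiv.ofBijective _ ((coverFace_bijective hfin hprod hgen).comp hcolor)
  have hadj : ∀ p q : Q ⊕ Q, (coveringSurface Q x hfin hprod hgen).dualGraph.Adj (f p) (f q) ↔
      (deltaY (signedCayley x)).Adj (e p) (e q) := by
    intro p q
    change (coveringSurface Q x hfin hprod hgen).dualGraph.Adj
      (coverFace hfin hprod hgen (color p)) (coverFace hfin hprod hgen (color q)) ↔ _
    rw [dualGraph_adj_iff]
    rcases p with h | w <;> rcases q with h' | w'
    · constructor
      · rintro ⟨hc, -⟩
        simp [color] at hc
      · rintro ⟨ha, hn⟩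
        obtain ⟨w, h1, h2⟩ := exists_mem_whiteTriangle_of_adj hprod ha
        exact absurd ⟨_, isNClique_whiteTriangle hprod hinj w, h1, h2⟩ hn
    · change _ ↔ h ∈ whiteTriangle x w'
      rw [mem_whiteTriangle]
      simp [color, mul_inv_eq_iff_eq_mul]
    · change _ ↔ h' ∈ whiteTriangle x w
      rw [mem_whiteTriangle]
      simp [color, eq_comm]
    · constructor
      · rintro ⟨hc, -⟩
        simp [color] at hc
      · exact False.elim
  exact ⟨⟨e.symm.trans f, fun {a b} => by
    have := hadj (e.symm a) (e.symm b)
    rwa [Equiv.apply_symm_apply, Equiv.apply_symm_apply] at this⟩⟩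

end Dual

theorem proposition4 :
    -- the triangulations `Π_N` of `S(Π_N)`, with `N = n + 2`
    Tendsto (fun n : ℕ => 6 * ((platonicSurface (n + 2)).genus : ℝ) /
      (Nat.card (platonicGraph (n + 2)).edgeSet : ℝ)) atTop (𝓝 1) ∧
    -- the triangulations `T_k^*` of `S(T_k)`
    Tendsto (fun k : ℕ => 6 * ((surfaceT k).genus : ℝ) /
      (Nat.card (surfaceT k).Edge : ℝ)) atTop (𝓝 1) ∧
    -- this triangulation is dual to `T_k` and has as many edges as `T_k`
    ∀ k : ℕ, 2 ≤ k → Nonempty (graphT k ≃g (surfaceT k).dualGraph) ∧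
      Nat.card (graphT k).edgeSet = Nat.card (surfaceT k).Edge := by
  refine ⟨tendsto_platonic, tendsto_surfaceT, fun k hk => ?_⟩
  have hinj := signedGen_genGk_injective hk
  have hiso : Nonempty (graphT k ≃g (surfaceT k).dualGraph) :=
    nonempty_deltaY_iso_dualGraph (genGk_prod k) hinj
      (fun _ _ _ h => isCyclicTriple_of_mul_eq_one hk h) (groupGk_finite k) (genGk_closure k)
  refine ⟨hiso, ?_⟩
  obtain ⟨φ⟩ := hiso
  rw [Nat.card_congr φ.mapEdgeSet]
  exact card_dualGraph_edgeSet (groupGk_finite k) (genGk_prod k) (genGk_closure k)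
    (crossing_injective hinj)
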